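/- Two content providers $k=1,2$ serve a common set $S_0$ of $b_0 n$ unit-size files, and provider $k$ serves in addition a private set $S_k$ of $b_k n$ files ($b_0,b_1,b_2\ge 1$ fixed integers, $n=1,2,\dots$). Requests form independent Poisson processes: requests made through provider $k$ arrive at rate $\lambda_{0,k}>0$ for $S_0$ and at rate $\lambda_k>0$ for $S_k$. The popularities are given by distribution functions $F_{0,1},F_{0,2},F_1,F_2$ on $[0,1]$ that are continuous, nondecreasing, equal to $0$ at $0$ and to $1$ at $1$, and continuously differentiable in $(0,1)$ except possibly at countably many points (the derivative may be unbounded near the endpoints): a request through provider $k$ for $S_0$ is for the $i$-th file with probability $F_{0,k}\bigl(\tfrac{i}{b_0n}\bigr)-F_{0,k}\bigl(\tfrac{i-1}{b_0n}\bigr)$, and a request for $S_k$ is for the $i$-th file with probability $F_k\bigl(\tfrac{i}{b_kn}\bigr)-F_k\bigl(\tfrac{i-1}{b_kn}\bigr)$. A cache of size $C^{(n)}$ with $C^{(n)}/n\to\beta\ge 0$ is divided into partitions, each operated under the LRU policy. Under Strategy 2 there are two partitions, and partition $k$ serves all requests made through provider $k$ (so that a common file may be stored twice). Under Strategy 3 there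 are three partitions: one serves all requests for $S_0$, through either provider, and keeps at most one copy of each file, and for $k=1,2$ one serves the requests for $S_k$. For an allocation $\gamma=(\gamma_p)$ with $\gamma_p\ge 0$ and $\sum_p\gamma_p\le\beta$, partition $p$ has size $C_p^{(n)}$ with $C_p^{(n)}/n\to\gamma_p$. Assume that $F_{0,1}=F_{0,2}$. Then, for both strategies and every allocation $\gamma$, the steady-state aggregate hit probability (the probability that an arbitrary request finds its file in the partition that serves it) exists for every $n$ and converges, as $n\to\infty$, to a limit that depends only on the workload, the strategy and $\gamma$; for both strategies this limit attains a maximum $M^{(s2)}$, respectively $M^{(s3)}$, over all allocations $\gamma$, and $$M^{(s3)}\ \ge\ M^{(s2)} .$$ -/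

import Mathlib

open Filter Topology

namespace LRUCache

/-! ### The LRU policy -/

/-- One step of an LRU cache of capacity `C`. The state lists the cached files, the most recently
requested one first. The requested file `x` moves to (or enters at) the front, and the least
recently requested file is evicted if the capacity is exceeded. -/
def lruStep {α : Type} [DecidableEq α] (C : ℕ) (s : List α) (x : α) : List α :=
  (x :: s.erase x).take C

section Partitioned

variable {R V P : Type} [DecidableEq V] [DecidableEq P]

/-- State of a partitioned cache, every partition `p` being an LRU cache of capacity `C p`, after
the requests in the list (oldest first), started empty. A request `r` is for the file `file r` and
is directed to the partition `route r`; it does not affect the other partitions. -/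
def cacheAfter (file : R → V) (route : R → P) (C : P → ℕ) (l : List R) : P → List V :=
  l.foldl (fun s r => Function.update s (route r) (lruStep (C (route r)) (s (route r)) (file r)))
    (fun _ => [])

/-- For independent requests with common law `q`, the probability that a request which is preceded
by exactly `t` requests is a hit, i.e. finds its file in the partition to which it is directed. -/
noncomputable def hitProbAfter [Fintype R] (q : R → ℝ) (file : R → V) (route : R → P)
    (C : P → ℕ) (t : ℕ) : ℝ :=
  ∑ ω : Fin t → R, ∑ r : R, (∏ j, q (ω j)) * q r *
    (if file r ∈ cacheAfter file route C (List.ofFn ω) (route r) then 1 else 0)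

end Partitioned

/-! ### Popularity distributions -/

/-- An asymptotic popularity distribution: a continuous distribution function on `[0, 1]` that is
continuously differentiable in `(0, 1)`, except possibly at countably many points. Nothing is
assumed about the derivative near `0` and `1`; it may be unbounded there. -/
structure IsPopularityDistribution (F : ℝ → ℝ) : Prop where
  zero : F 0 = 0
  one : F 1 = 1
  mono : MonotoneOn F (Set.Icc 0 1)
  cont : ContinuousOn F (Set.Icc 0 1)
  contDiff : ∃ S : Set ℝ, S.Countable ∧ (∀ x ∈ Set.Ioo 0 1 \ S, DifferentiableAt ℝ F x) ∧
    ContinuousOn (deriv F) (Set.Ioo 0 1 \ S)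

/-- The popularity `F ((i + 1) / N) - F (i / N)` of the `i`-th of `N` files (`i = 0, …, N - 1`). -/
noncomputable def popularity (F : ℝ → ℝ) (N : ℕ) (i : Fin N) : ℝ :=
  F (((i : ℕ) + 1 : ℝ) / N) - F (((i : ℕ) : ℝ) / N)

/-! ### Two providers with common content -/

/-- The data of the two-provider model. The providers are indexed by `Fin 2`. At scale `n` there
are `b₀ * n` common files, and `b k * n` files that only provider `k` serves. -/
structure Workload where
  /-- relative number of common files -/
  b₀ : ℕ
  /-- relative numbers of private files -/
  b : Fin 2 → ℕ
  /-- rates of the requests made through provider `k` for common files -/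
  rate₀ : Fin 2 → ℝ
  /-- rates of the requests made through provider `k` for its private files -/
  rate : Fin 2 → ℝ
  /-- popularity distribution of the common files among the requests through provider `k` -/
  F₀ : Fin 2 → ℝ → ℝ
  /-- popularity distributions of the private files -/
  F : Fin 2 → ℝ → ℝ

namespace Workload

variable (W : Workload)

/-- The files: the common ones and the private ones of the two providers. -/
abbrev File (n : ℕ) : Type := Fin (W.b₀ * n) ⊕ (Σ k : Fin 2, Fin (W.b k * n))

/-- The kinds of requests: a provider, and a common file or a private file of this provider. -/
abbrev Request (n : ℕ) : Type := Σ k : Fin 2, Fin (W.b₀ * n) ⊕ Fin (W.b k * n)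

/-- The requested file. A common file is the same file whichever provider is asked for it. -/
def file (n : ℕ) : W.Request n → W.File n
  | ⟨_, Sum.inl i⟩ => Sum.inl i
  | ⟨k, Sum.inr i⟩ => Sum.inr ⟨k, i⟩

/-- The rate of the Poisson process of requests of a given kind. -/
noncomputable def requestRate (n : ℕ) : W.Request n → ℝ
  | ⟨k, Sum.inl i⟩ => W.rate₀ k * popularity (W.F₀ k) (W.b₀ * n) i
  | ⟨k, Sum.inr i⟩ => W.rate k * popularity (W.F k) (W.b k * n) i

/-- The law of a request in the superposition of these independent Poisson processes: the
successive requests are independent, and each is of kind `r` with probability proportional to the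
rate of `r`. -/
noncomputable def requestProb (n : ℕ) (r : W.Request n) : ℝ :=
  W.requestRate n r / ∑ k, (W.rate₀ k + W.rate k)

/-- Strategy 2: one partition for each provider. -/
def route₂ (n : ℕ) : W.Request n → Fin 2
  | ⟨k, _⟩ => k

/-- Strategy 3: partition `0` for the common files, and one partition for the private files of
each provider. -/
def route₃ (n : ℕ) : W.Request n → Fin 3
  | ⟨_, Sum.inl _⟩ => 0
  | ⟨k, Sum.inr _⟩ => k.succ

variable {P : Type} [DecidableEq P]

/-- `h` is the asymptotic aggregate hit probability when the requests are directed to LRU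
partitions by `route` and partition `p` has asymptotically `γ p * n` places: at each scale `n` the
hit probability reaches a steady-state value `g n`, and `g n → h` as `n → ∞`. -/
def IsAsymptoticHitProb (route : ∀ n, W.Request n → P) (γ : P → ℝ) (h : ℝ) : Prop :=
  ∀ C : ℕ → P → ℕ, (∀ p, Tendsto (fun n => (C n p : ℝ) / n) atTop (𝓝 (γ p))) →
    ∃ g : ℕ → ℝ,
      (∀ n, 0 < n → Tendsto (fun t => hitProbAfter (W.requestProb n) (W.file n) (route n) (C n) t)
        atTop (𝓝 (g n))) ∧
      Tendsto g atTop (𝓝 h)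

/-- The ways to divide a cache of normalized size `β` among the partitions. -/
def allocations (P : Type) [Fintype P] (β : ℝ) : Set (P → ℝ) :=
  {γ | (∀ p, 0 ≤ γ p) ∧ ∑ p, γ p ≤ β}

/-- `M` is the asymptotic aggregate hit probability under an optimal division among the partitions
of a cache of normalized size `β`. -/
def IsOptimalHitProb [Fintype P] (route : ∀ n, W.Request n → P) (β M : ℝ) : Prop :=
  ∃ h : (P → ℝ) → ℝ, (∀ γ ∈ allocations P β, W.IsAsymptoticHitProb route γ (h γ)) ∧
    IsGreatest (h '' allocations P β) M

end Workload

end LRUCache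

namespace LRUCache

/-! ### The contents of an LRU cache -/

section Recency

variable {α : Type} [DecidableEq α]

/-- The distinct members of a list of requests (oldest first), the most recently requested one
first. -/
def recency (l : List α) : List α :=
  l.foldl (fun s x => x :: s.erase x) []

@[simp]
theorem recency_concat (l : List α) (x : α) :
    recency (l ++ [x]) = x :: (recency l).erase x := by
  simp [recency]

theorem nodup_recency (l : List α) : (recency l).Nodup := by
  induction l using List.reverseRecOn with
  | nil => simp [recency]
  | append_singleton l x ih =>
    rw [recency_concat, List.nodup_cons]
    exact ⟨ih.not_mem_erase, ih.erase x⟩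

theorem mem_recency {l : List α} {y : α} : y ∈ recency l ↔ y ∈ l := by
  induction l using List.reverseRecOn with
  | nil => simp [recency]
  | append_singleton l x ih =>
    rw [recency_concat, List.mem_cons, List.mem_append, List.mem_singleton, ← ih]
    by_cases h : y = x
    · simp [h]
    · simp [h, List.mem_erase_of_ne h]

theorem length_recency (l : List α) : (recency l).length = l.toFinset.card := by
  rw [← List.toFinset_card_of_nodup (nodup_recency l)]
  congr 1
  ext y
  simp [mem_recency]

theorem recency_prefix (l₁ l₂ : List α) : recency l₂ <+: recency (l₁ ++ l₂) := by
  induction l₂ using List.reverseRecOn with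
  | nil => simp [recency]
  | append_singleton l x ih =>
    rw [← List.append_assoc, recency_concat, recency_concat]
    obtain ⟨s, hs⟩ := ih
    rw [← hs, List.cons_prefix_cons]
    refine ⟨rfl, ?_⟩
    by_cases hx : x ∈ recency l
    · rw [List.erase_append_left _ hx]
      exact List.prefix_append _ _
    · rw [List.erase_append_right _ hx, List.erase_of_not_mem hx]
      exact List.prefix_append _ _

theorem lruStep_take (C : ℕ) (s : List α) (x : α) :
    lruStep C (s.take C) x = (x :: s.erase x).take C := by
  cases C with
  | zero => simp [lruStep]
  | succ C =>
    simp only [lruStep, List.take_succ_cons, List.cons.injEq, true_and]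
    induction s generalizing C with
    | nil => simp
    | cons y s ih =>
      by_cases h : y = x
      · subst h
        simp [List.take_take]
      · cases C with
        | zero => simp
        | succ C =>
          rw [List.take_succ_cons, List.erase_cons_tail (by simpa using h),
            List.erase_cons_tail (by simpa using h), List.take_succ_cons, List.take_succ_cons, ih]

end Recency

section Partitioned

variable {R V P : Type} [DecidableEq V] [DecidableEq P]

/-- The files requested from partition `p`, in the order of the requests. -/
def filesAt (file : R → V) (route : R → P) (p : P) (l : List R) : List V :=
  (l.filter (fun r => route r = p)).map file

omit [DecidableEq V] in
theorem filesAt_append (file : R → V) (route : R → P) (p : P) (l₁ l₂ : List R) :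
    filesAt file route p (l₁ ++ l₂) = filesAt file route p l₁ ++ filesAt file route p l₂ := by
  simp [filesAt]

theorem cacheAfter_eq (file : R → V) (route : R → P) (C : P → ℕ) (l : List R) (p : P) :
    cacheAfter file route C l p = (recency (filesAt file route p l)).take (C p) := by
  induction l using List.reverseRecOn with
  | nil => simp [cacheAfter, filesAt, recency]
  | append_singleton l r ih =>
    have h : cacheAfter file route C (l ++ [r]) = Function.update (cacheAfter file route C l)
        (route r) (lruStep (C (route r)) (cacheAfter file route C l (route r)) (file r)) := by
      simp [cacheAfter]
    rw [h, filesAt_append]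
    by_cases hp : route r = p
    · subst hp
      rw [Function.update_self, ih, lruStep_take]
      simp [filesAt]
    · rw [Function.update_of_ne (Ne.symm hp), ih]
      simp [filesAt, hp]

theorem mem_cacheAfter_append_left {file : R → V} {route : R → P} {C : P → ℕ} {l₂ : List R}
    {p : P} {v : V} (l₁ : List R) (h : v ∈ cacheAfter file route C l₂ p) :
    v ∈ cacheAfter file route C (l₁ ++ l₂) p := by
  rw [cacheAfter_eq] at h ⊢
  rw [filesAt_append]
  exact ((recency_prefix _ _).take _).subset h

theorem mem_cacheAfter_of_card_le {file : R → V} {route : R → P} {C : P → ℕ} {l₂ : List R}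
    {p : P} {v : V} (l₁ : List R) (hv : v ∈ filesAt file route p l₂)
    (hC : (filesAt file route p l₂).toFinset.card ≤ C p) :
    v ∈ cacheAfter file route C (l₁ ++ l₂) p := by
  refine mem_cacheAfter_append_left l₁ ?_
  rw [cacheAfter_eq, List.take_of_length_le (by rwa [length_recency])]
  exact mem_recency.2 hv

theorem mem_filesAt_of_le_card {file : R → V} {route : R → P} {C : P → ℕ} {l₁ l₂ : List R}
    {p : P} {v : V} (hv : v ∈ cacheAfter file route C (l₁ ++ l₂) p)
    (hC : C p ≤ (filesAt file route p l₂).toFinset.card) : v ∈ filesAt file route p l₂ := by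
  rw [cacheAfter_eq, filesAt_append] at hv
  obtain ⟨s, hs⟩ := recency_prefix (filesAt file route p l₁) (filesAt file route p l₂)
  rw [← hs, List.take_append_of_le_length (by rwa [length_recency])] at hv
  exact mem_recency.1 (List.mem_of_mem_take hv)

end Partitioned

/-! ### Expectations over independent requests -/

section Expect

variable {R : Type} [Fintype R]

/-- The expectation of a function of `t` independent requests with common law `q`. -/
noncomputable def expect (q : R → ℝ) (t : ℕ) (g : (Fin t → R) → ℝ) : ℝ :=
  ∑ ω : Fin t → R, (∏ j, q (ω j)) * g ω

variable {q : R → ℝ} {t : ℕ}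

theorem expect_mono (hq : ∀ r, 0 ≤ q r) {g h : (Fin t → R) → ℝ} (hgh : ∀ ω, g ω ≤ h ω) :
    expect q t g ≤ expect q t h :=
  Finset.sum_le_sum fun ω _ => mul_le_mul_of_nonneg_left (hgh ω) (Finset.prod_nonneg fun _ _ => hq _)

theorem expect_add (g h : (Fin t → R) → ℝ) :
    expect q t (fun ω => g ω + h ω) = expect q t g + expect q t h := by
  simp [expect, mul_add, Finset.sum_add_distrib]

theorem expect_sub (g h : (Fin t → R) → ℝ) :
    expect q t (fun ω => g ω - h ω) = expect q t g - expect q t h := by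
  simp [expect, mul_sub, Finset.sum_sub_distrib]

theorem expect_const_mul (c : ℝ) (g : (Fin t → R) → ℝ) :
    expect q t (fun ω => c * g ω) = c * expect q t g := by
  simp only [expect, Finset.mul_sum]
  exact Finset.sum_congr rfl fun ω _ => by ring

theorem expect_sum {ι : Type} (s : Finset ι) (g : ι → (Fin t → R) → ℝ) :
    expect q t (fun ω => ∑ i ∈ s, g i ω) = ∑ i ∈ s, expect q t (g i) := by
  simp only [expect, Finset.mul_sum]
  exact Finset.sum_comm

theorem expect_const (hq : ∑ r, q r = 1) (c : ℝ) : expect q t (fun _ => c) = c := by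
  rw [expect, ← Finset.sum_mul, ← Fintype.sum_pow, hq, one_pow, one_mul]

theorem expect_append (s : ℕ) (g : (Fin (s + t) → R) → ℝ) :
    expect q (s + t) g = expect q s (fun ω₁ => expect q t (fun ω₂ => g (Fin.append ω₁ ω₂))) := by
  rw [expect, ← (Fin.appendEquiv s t).sum_comp, Fintype.sum_prod_type]
  simp only [expect, Finset.mul_sum]
  refine Finset.sum_congr rfl fun ω₁ _ => Finset.sum_congr rfl fun ω₂ _ => ?_
  simp [Fin.appendEquiv, Fin.prod_univ_add, mul_assoc]

/-- The probability that none of `t` independent requests belongs to `A`. -/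
theorem expect_forall_notMem (hq : ∑ r, q r = 1) (A : R → Prop) [DecidablePred A] :
    expect q t (fun ω => if ∀ j, ¬ A (ω j) then 1 else 0) = (1 - ∑ r with A r, q r) ^ t := by
  classical
  have h1 : 1 - ∑ r with A r, q r = ∑ r with ¬ A r, q r := by
    rw [← hq, ← Finset.sum_filter_add_sum_filter_not Finset.univ A q]
    ring
  have h2 := Finset.prod_univ_sum (fun _ : Fin t => Finset.univ.filter fun r => ¬ A r)
    (fun _ r => q r)
  rw [Finset.prod_const, Finset.card_univ, Fintype.card_fin] at h2
  rw [h1, h2, expect]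
  simp only [mul_ite, mul_one, mul_zero]
  rw [← Finset.sum_filter]
  refine Finset.sum_congr ?_ fun _ _ => rfl
  ext ω
  simp [Fintype.mem_piFinset]

end Expect

/-! ### The hit probability of a single partition -/

section PartitionHit

variable {R V P : Type} [Fintype R] [Fintype V] [DecidableEq V] [DecidableEq P]

/-- The probability that a request is for the file `v` and directed to the partition `p`. -/
noncomputable def mass (q : R → ℝ) (file : R → V) (route : R → P) (p : P) (v : V) : ℝ :=
  ∑ r with route r = p ∧ file r = v, q r

/-- The probability that a request which is preceded by exactly `t` requests is directed to the
partition `p` and is a hit. -/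
noncomputable def partitionHit (q : R → ℝ) (file : R → V) (route : R → P) (C : P → ℕ) (p : P)
    (t : ℕ) : ℝ :=
  ∑ v, mass q file route p v *
    expect q t (fun ω => if v ∈ cacheAfter file route C (List.ofFn ω) p then 1 else 0)

theorem sum_mass_mul (q : R → ℝ) (file : R → V) (route : R → P) (p : P) (g : V → ℝ) :
    ∑ v, mass q file route p v * g v = ∑ r with route r = p, q r * g (file r) := by
  rw [← Finset.sum_fiberwise _ file]
  refine Finset.sum_congr rfl fun v _ => ?_
  rw [mass, Finset.sum_mul, Finset.filter_filter]
  refine Finset.sum_congr rfl fun r hr => ?_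
  rw [(Finset.mem_filter.1 hr).2.2]

theorem hitProbAfter_eq_sum [Fintype P] (q : R → ℝ) (file : R → V) (route : R → P) (C : P → ℕ)
    (t : ℕ) : hitProbAfter q file route C t = ∑ p, partitionHit q file route C p t := by
  simp only [partitionHit, sum_mass_mul]
  have h : ∀ p, ∑ r with route r = p, q r * expect q t
        (fun ω => if file r ∈ cacheAfter file route C (List.ofFn ω) p then 1 else 0)
      = ∑ r with route r = p, q r * expect q t
        (fun ω => if file r ∈ cacheAfter file route C (List.ofFn ω) (route r) then 1 else 0) :=
    fun p => Finset.sum_congr rfl fun r hr => by rw [(Finset.mem_filter.1 hr).2]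
  rw [Finset.sum_congr rfl fun p _ => h p, Finset.sum_fiberwise, hitProbAfter, Finset.sum_comm]
  refine Finset.sum_congr rfl fun r _ => ?_
  rw [expect, Finset.mul_sum]
  exact Finset.sum_congr rfl fun ω _ => by ring

variable {q : R → ℝ} {file : R → V} {route : R → P} {C : P → ℕ} {p : P}

omit [Fintype V] in
theorem mass_nonneg (hq : ∀ r, 0 ≤ q r) (v : V) : 0 ≤ mass q file route p v :=
  Finset.sum_nonneg fun r _ => hq r

theorem sum_mass_le_one (hq : ∀ r, 0 ≤ q r) (hq1 : ∑ r, q r = 1) :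
    ∑ v, mass q file route p v ≤ 1 := by
  have h := sum_mass_mul q file route p (fun _ => 1)
  simp only [mul_one] at h
  rw [h, ← hq1]
  exact Finset.sum_le_sum_of_subset_of_nonneg (Finset.filter_subset _ _) fun r _ _ => hq r

theorem partitionHit_nonneg (hq : ∀ r, 0 ≤ q r) (t : ℕ) : 0 ≤ partitionHit q file route C p t :=
  Finset.sum_nonneg fun v _ => mul_nonneg (mass_nonneg hq v) <|
    Finset.sum_nonneg fun ω _ => mul_nonneg (Finset.prod_nonneg fun _ _ => hq _)
      (by beta_reduce; split_ifs <;> norm_num)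

theorem partitionHit_le (hq : ∀ r, 0 ≤ q r) (hq1 : ∑ r, q r = 1) (t : ℕ) :
    partitionHit q file route C p t ≤ ∑ v, mass q file route p v := by
  refine Finset.sum_le_sum fun v _ => mul_le_of_le_one_right (mass_nonneg hq v) ?_
  refine (expect_mono hq (h := fun _ => 1) fun ω => ?_).trans (expect_const hq1 1).le
  split_ifs <;> norm_num

theorem partitionHit_monotone (hq : ∀ r, 0 ≤ q r) (hq1 : ∑ r, q r = 1) :
    Monotone (partitionHit q file route C p) := by
  refine monotone_nat_of_le_succ fun t => ?_
  refine Finset.sum_le_sum fun v _ => mul_le_mul_of_nonneg_left ?_ (mass_nonneg hq v)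
  rw [add_comm, expect_append]
  refine (expect_const (t := 1) hq1 _).symm.le.trans (expect_mono hq fun ω₁ => ?_)
  refine expect_mono hq fun ω₂ => ?_
  rw [List.ofFn_fin_append]
  split_ifs with h1 h2 h2
  · exact le_rfl
  · exact absurd (mem_cacheAfter_append_left _ h1) h2
  · norm_num
  · exact le_rfl

/-- The indicator function of the event that the file `v` is not requested from the partition
`p`. -/
def absent (file : R → V) (route : R → P) (p : P) {m : ℕ} (v : V) (ω : Fin m → R) : ℝ :=
  if ∀ j, ¬ (route (ω j) = p ∧ file (ω j) = v) then 1 else 0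

omit [Fintype R] [Fintype V] in
theorem absent_eq {m : ℕ} (v : V) (ω : Fin m → R) :
    absent file route p v ω = if v ∈ filesAt file route p (List.ofFn ω) then 0 else 1 := by
  have h : v ∈ filesAt file route p (List.ofFn ω) ↔
      ¬ ∀ j, ¬ (route (ω j) = p ∧ file (ω j) = v) := by
    simp [filesAt, List.mem_ofFn]
  simp only [absent, h, ite_not]

omit [Fintype R] in
theorem card_filesAt {m : ℕ} (ω : Fin m → R) :
    ((filesAt file route p (List.ofFn ω)).toFinset.card : ℝ)
      = ∑ v, (1 - absent file route p v ω) := by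
  simp only [absent_eq]
  have h : ∀ v, (1 - (if v ∈ filesAt file route p (List.ofFn ω) then 0 else 1) : ℝ)
      = if v ∈ (filesAt file route p (List.ofFn ω)).toFinset then 1 else 0 := fun v => by
    simp only [List.mem_toFinset]
    split_ifs <;> norm_num
  rw [Finset.sum_congr rfl fun v _ => h v, Finset.sum_boole]
  simp only [Finset.filter_univ_mem]

omit [Fintype V] in
theorem expect_absent (hq1 : ∑ r, q r = 1) (m : ℕ) (v : V) :
    expect q m (absent file route p v) = (1 - mass q file route p v) ^ m :=
  expect_forall_notMem hq1 (fun r => route r = p ∧ file r = v)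

theorem mass_add_mass_le (hq : ∀ r, 0 ≤ q r) (hq1 : ∑ r, q r = 1) {v w : V} (hvw : v ≠ w) :
    mass q file route p v + mass q file route p w ≤ 1 := by
  refine le_trans ?_ (sum_mass_le_one (file := file) (route := route) (p := p) hq hq1)
  rw [← Finset.sum_pair hvw]
  exact Finset.sum_le_sum_of_subset_of_nonneg (Finset.subset_univ _) fun u _ _ => mass_nonneg hq u

theorem mass_le_one (hq : ∀ r, 0 ≤ q r) (hq1 : ∑ r, q r = 1) (v : V) :
    mass q file route p v ≤ 1 :=
  (Finset.single_le_sum (fun u _ => mass_nonneg hq u) (Finset.mem_univ v)).trans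
    (sum_mass_le_one hq hq1)

/-- The absences of two distinct files are negatively correlated. -/
theorem expect_absent_mul_le (hq : ∀ r, 0 ≤ q r) (hq1 : ∑ r, q r = 1) (m : ℕ) {v w : V}
    (hvw : v ≠ w) :
    expect q m (fun ω => absent file route p v ω * absent file route p w ω)
      ≤ (1 - mass q file route p v) ^ m * (1 - mass q file route p w) ^ m := by
  have h1 : (fun ω : Fin m → R => absent file route p v ω * absent file route p w ω) = fun ω =>
      if ∀ j, ¬ ((route (ω j) = p ∧ file (ω j) = v) ∨ (route (ω j) = p ∧ file (ω j) = w))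
      then 1 else 0 := by
    funext ω
    simp only [absent, not_or, forall_and, ← ite_and, mul_ite, mul_one, mul_zero]
    simp only [and_comm]
  have h2 : ∑ r with (route r = p ∧ file r = v) ∨ (route r = p ∧ file r = w), q r
      = mass q file route p v + mass q file route p w := by
    classical
    rw [Finset.filter_or, Finset.sum_union, mass, mass]
    rw [Finset.disjoint_filter]
    rintro r - ⟨-, hv⟩ ⟨-, hw⟩
    exact hvw (hv.symm.trans hw)
  rw [h1, expect_forall_notMem hq1
    (fun r => (route r = p ∧ file r = v) ∨ (route r = p ∧ file r = w)), h2, ← mul_pow]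
  refine pow_le_pow_left₀ ?_ ?_ m
  · linarith [mass_add_mass_le (file := file) (route := route) (p := p) hq hq1 hvw]
  · nlinarith [mul_nonneg (mass_nonneg (file := file) (route := route) (p := p) hq v)
      (mass_nonneg (file := file) (route := route) (p := p) hq w)]

/-- The variance of the number of files that are not requested is at most the number of files. -/
theorem expect_sq_le (hq : ∀ r, 0 ≤ q r) (hq1 : ∑ r, q r = 1) (m : ℕ) :
    expect q m (fun ω => (∑ v, (absent file route p v ω - (1 - mass q file route p v) ^ m)) ^ 2)
      ≤ Fintype.card V := by
  set a : V → ℝ := fun v => (1 - mass q file route p v) ^ m with ha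
  have ha0 : ∀ v, 0 ≤ a v := fun v => pow_nonneg (sub_nonneg.2 (mass_le_one hq hq1 v)) m
  have ha1 : ∀ v, a v ≤ 1 := fun v => pow_le_one₀ (sub_nonneg.2 (mass_le_one hq hq1 v))
    (sub_le_self _ (mass_nonneg hq v))
  have hcov : ∀ v w, expect q m (fun ω => (absent file route p v ω - a v) *
      (absent file route p w ω - a w))
      = expect q m (fun ω => absent file route p v ω * absent file route p w ω) - a v * a w := by
    intro v w
    have h : (fun ω : Fin m → R => (absent file route p v ω - a v) * (absent file route p w ω - a w))
        = fun ω => (absent file route p v ω * absent file route p w ω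
          - a w * absent file route p v ω) - (a v * absent file route p w ω - a v * a w) := by
      funext ω; ring
    rw [h, expect_sub, expect_sub, expect_sub, expect_const_mul, expect_const_mul,
      expect_const hq1, expect_absent hq1, expect_absent hq1]
    ring
  have hsq : (fun ω : Fin m → R => (∑ v, (absent file route p v ω - a v)) ^ 2)
      = fun ω => ∑ v, ∑ w, (absent file route p v ω - a v) * (absent file route p w ω - a w) := by
    funext ω
    rw [sq, Finset.sum_mul_sum]
  change expect q m (fun ω => (∑ v, (absent file route p v ω - a v)) ^ 2) ≤ _
  rw [hsq, expect_sum, ← nsmul_one, ← Finset.card_univ, ← Finset.sum_const]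
  refine Finset.sum_le_sum fun v _ => ?_
  rw [expect_sum]
  refine (Finset.sum_le_sum (g := fun w => if w = v then 1 else 0) fun w _ => ?_).trans (by simp)
  rw [hcov]
  split_ifs with hw
  · subst hw
    have hidem : (fun ω : Fin m → R => absent file route p w ω * absent file route p w ω)
        = absent file route p w := by
      funext ω
      simp [absent]
    rw [hidem, expect_absent hq1]
    nlinarith [ha1 w, mul_nonneg (ha0 w) (ha0 w)]
  · linarith [expect_absent_mul_le (file := file) (route := route) (p := p) hq hq1 m (Ne.symm hw)]

/-- The expected number of distinct files among `m` requests, if `Q` gives the probabilities. -/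
noncomputable def distinctMean (Q : V → ℝ) (m : ℕ) : ℝ := ∑ v, (1 - (1 - Q v) ^ m)

/-- The probability that the file of a request is among those of `m` other requests. -/
noncomputable def repeatProb (Q : V → ℝ) (m : ℕ) : ℝ := ∑ v, Q v * (1 - (1 - Q v) ^ m)

omit [Fintype R] in
theorem sum_absent_sub {m : ℕ} (ω : Fin m → R) (Q : V → ℝ) :
    ∑ v, (absent file route p v ω - (1 - Q v) ^ m)
      = distinctMean Q m - (filesAt file route p (List.ofFn ω)).toFinset.card := by
  rw [card_filesAt, distinctMean, ← Finset.sum_sub_distrib]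
  exact Finset.sum_congr rfl fun v _ => by ring

theorem partitionHit_le_repeatProb (hq : ∀ r, 0 ≤ q r) (hq1 : ∑ r, q r = 1) {m : ℕ} {δ : ℝ}
    (hδ : 0 < δ) (hC : C p + δ ≤ distinctMean (mass q file route p) m) (s : ℕ) :
    partitionHit q file route C p (s + m)
      ≤ repeatProb (mass q file route p) m + Fintype.card V / δ ^ 2 := by
  have key : ∀ v, expect q (s + m)
      (fun ω => if v ∈ cacheAfter file route C (List.ofFn ω) p then 1 else 0)
      ≤ (1 - (1 - mass q file route p v) ^ m) + Fintype.card V / δ ^ 2 := by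
    intro v
    rw [expect_append]
    refine (expect_mono hq fun ω₁ => ?_).trans (expect_const (t := s) hq1 _).le
    refine (expect_mono hq (h := fun ω₂ => (1 - absent file route p v ω₂) + (δ ^ 2)⁻¹ *
      (∑ v, (absent file route p v ω₂ - (1 - mass q file route p v) ^ m)) ^ 2) fun ω₂ => ?_).trans ?_
    · rw [List.ofFn_fin_append, absent_eq]
      have hY := mul_nonneg (inv_nonneg.2 (sq_nonneg δ))
        (sq_nonneg (∑ v, (absent file route p v ω₂ - (1 - mass q file route p v) ^ m)))
      split_ifs with h1 h2 h2
      · linarith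
      · have hlt : (filesAt file route p (List.ofFn ω₂)).toFinset.card < C p := by
          by_contra hge
          exact h2 (mem_filesAt_of_le_card h1 (not_lt.1 hge))
        have hlt' : ((filesAt file route p (List.ofFn ω₂)).toFinset.card : ℝ) < C p := by
          exact_mod_cast hlt
        rw [sum_absent_sub, sub_self, zero_add, ← div_eq_inv_mul, one_le_div (by positivity)]
        exact pow_le_pow_left₀ hδ.le (by linarith) 2
      · linarith
      · linarith
    · rw [expect_add, expect_sub, expect_const hq1, expect_const_mul, expect_absent hq1,
        div_eq_inv_mul]
      gcongr
      exact expect_sq_le hq hq1 m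
  have hsum := sum_mass_le_one (file := file) (route := route) (p := p) hq hq1
  calc partitionHit q file route C p (s + m)
      ≤ ∑ v, mass q file route p v *
          ((1 - (1 - mass q file route p v) ^ m) + Fintype.card V / δ ^ 2) :=
        Finset.sum_le_sum fun v _ => mul_le_mul_of_nonneg_left (key v) (mass_nonneg hq v)
    _ = repeatProb (mass q file route p) m
          + (∑ v, mass q file route p v) * (Fintype.card V / δ ^ 2) := by
        simp only [mul_add, Finset.sum_add_distrib, repeatProb, Finset.sum_mul]
    _ ≤ _ := by
        gcongr
        exact mul_le_of_le_one_left (by positivity) hsum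

theorem repeatProb_le_partitionHit (hq : ∀ r, 0 ≤ q r) (hq1 : ∑ r, q r = 1) {m : ℕ} {δ : ℝ}
    (hδ : 0 < δ) (hC : distinctMean (mass q file route p) m + δ ≤ C p) (s : ℕ) :
    repeatProb (mass q file route p) m - Fintype.card V / δ ^ 2
      ≤ partitionHit q file route C p (s + m) := by
  have key : ∀ v, (1 - (1 - mass q file route p v) ^ m) - Fintype.card V / δ ^ 2 ≤ expect q (s + m)
      (fun ω => if v ∈ cacheAfter file route C (List.ofFn ω) p then 1 else 0) := by
    intro v
    rw [expect_append]
    refine (expect_const (t := s) hq1 _).symm.le.trans (expect_mono hq fun ω₁ => ?_)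
    refine le_trans ?_ (expect_mono hq (g := fun ω₂ => (1 - absent file route p v ω₂) - (δ ^ 2)⁻¹ *
      (∑ v, (absent file route p v ω₂ - (1 - mass q file route p v) ^ m)) ^ 2) fun ω₂ => ?_)
    · rw [expect_sub, expect_sub, expect_const hq1, expect_const_mul, expect_absent hq1,
        div_eq_inv_mul]
      gcongr
      exact expect_sq_le hq hq1 m
    · rw [List.ofFn_fin_append, absent_eq]
      have hY := mul_nonneg (inv_nonneg.2 (sq_nonneg δ))
        (sq_nonneg (∑ v, (absent file route p v ω₂ - (1 - mass q file route p v) ^ m)))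
      split_ifs with h1 h2 h2
      · linarith
      · have hlt : C p < (filesAt file route p (List.ofFn ω₂)).toFinset.card := by
          by_contra hge
          exact h2 (mem_cacheAfter_of_card_le _ h1 (not_lt.1 hge))
        have hlt' : (C p : ℝ) < (filesAt file route p (List.ofFn ω₂)).toFinset.card := by
          exact_mod_cast hlt
        rw [sum_absent_sub, sub_zero, sub_nonpos, ← div_eq_inv_mul, one_le_div (by positivity),
          ← neg_sq (distinctMean _ _ - _)]
        exact pow_le_pow_left₀ hδ.le (by linarith) 2
      · linarith
      · linarith
  have hsum := sum_mass_le_one (file := file) (route := route) (p := p) hq hq1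
  calc repeatProb (mass q file route p) m - Fintype.card V / δ ^ 2
      ≤ repeatProb (mass q file route p) m
          - (∑ v, mass q file route p v) * (Fintype.card V / δ ^ 2) := by
        gcongr
        exact mul_le_of_le_one_left (by positivity) hsum
    _ = ∑ v, mass q file route p v *
          ((1 - (1 - mass q file route p v) ^ m) - Fintype.card V / δ ^ 2) := by
        simp only [mul_sub, Finset.sum_sub_distrib, repeatProb, Finset.sum_mul]
    _ ≤ _ := Finset.sum_le_sum fun v _ => mul_le_mul_of_nonneg_left (key v) (mass_nonneg hq v)

/-- The hit probability of a partition reaches a steady-state value. -/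
theorem exists_tendsto_partitionHit (C : P → ℕ) (p : P) (hq : ∀ r, 0 ≤ q r)
    (hq1 : ∑ r, q r = 1) :
    ∃ g, Tendsto (partitionHit q file route C p) atTop (𝓝 g) ∧
      0 ≤ g ∧ g ≤ ∑ v, mass q file route p v ∧
      (∀ m δ, 0 < δ → C p + δ ≤ distinctMean (mass q file route p) m →
        g ≤ repeatProb (mass q file route p) m + Fintype.card V / δ ^ 2) ∧
      (∀ m δ, 0 < δ → distinctMean (mass q file route p) m + δ ≤ C p →
        repeatProb (mass q file route p) m - Fintype.card V / δ ^ 2 ≤ g) := by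
  have hlim := tendsto_atTop_ciSup (partitionHit_monotone (file := file) (route := route) (C := C)
    (p := p) hq hq1) ⟨_, Set.forall_mem_range.2 (partitionHit_le hq hq1)⟩
  refine ⟨_, hlim, ge_of_tendsto' hlim (partitionHit_nonneg hq),
    le_of_tendsto' hlim (partitionHit_le hq hq1), fun m δ hδ h => ?_, fun m δ hδ h => ?_⟩
  · exact le_of_tendsto' (hlim.comp (tendsto_add_atTop_nat m))
      (partitionHit_le_repeatProb hq hq1 hδ h)
  · exact ge_of_tendsto' (hlim.comp (tendsto_add_atTop_nat m))
      (repeatProb_le_partitionHit hq hq1 hδ h)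

end PartitionHit

/-! ### Asymptotic profiles of a partition -/

/-- Asymptotically `K τ * n` distinct files are requested from a partition during a window of
`τ * n` requests, and a request is for one of them with probability `H τ`; the partition receives
the fraction `Q` of the requests. -/
structure IsProfile (K H : ℝ → ℝ) (Q : ℝ) : Prop where
  contK : ContinuousOn K (Set.Ici 0)
  strictMonoK : StrictMonoOn K (Set.Ici 0)
  zeroK : K 0 = 0
  contH : ContinuousOn H (Set.Ici 0)
  monoH : MonotoneOn H (Set.Ici 0)
  zeroH : H 0 = 0
  tendstoH : Tendsto H atTop (𝓝 Q)

/-- The asymptotic hit probability of a partition with `γ * n` places. -/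
noncomputable def hitLimit (K H : ℝ → ℝ) (γ : ℝ) : ℝ := sSup (H '' {τ | 0 ≤ τ ∧ K τ ≤ γ})

namespace IsProfile

variable {K H : ℝ → ℝ} {Q : ℝ}

theorem add {K' H' : ℝ → ℝ} {Q' : ℝ} (h : IsProfile K H Q) (h' : IsProfile K' H' Q') :
    IsProfile (fun τ => K τ + K' τ) (fun τ => H τ + H' τ) (Q + Q') where
  contK := h.contK.add h'.contK
  strictMonoK := h.strictMonoK.add h'.strictMonoK
  zeroK := by simp [h.zeroK, h'.zeroK]
  contH := h.contH.add h'.contH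
  monoH := h.monoH.add h'.monoH
  zeroH := by simp [h.zeroH, h'.zeroH]
  tendstoH := h.tendstoH.add h'.tendstoH

theorem nonnegK (h : IsProfile K H Q) {τ : ℝ} (hτ : 0 ≤ τ) : 0 ≤ K τ :=
  h.zeroK.symm.le.trans (h.strictMonoK.monotoneOn (le_refl (0 : ℝ)) hτ hτ)

theorem le (h : IsProfile K H Q) {τ : ℝ} (hτ : 0 ≤ τ) : H τ ≤ Q :=
  ge_of_tendsto h.tendstoH <| (eventually_ge_atTop τ).mono fun _ hs =>
    h.monoH hτ (hτ.trans hs : (0 : ℝ) ≤ _) hs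

theorem bddAbove (h : IsProfile K H Q) (γ : ℝ) : BddAbove (H '' {τ | 0 ≤ τ ∧ K τ ≤ γ}) :=
  ⟨Q, by rintro _ ⟨τ, hτ, rfl⟩; exact h.le hτ.1⟩

theorem le_hitLimit (h : IsProfile K H Q) {γ τ : ℝ} (hτ : 0 ≤ τ) (hK : K τ ≤ γ) :
    H τ ≤ hitLimit K H γ :=
  le_csSup (h.bddAbove γ) ⟨τ, ⟨hτ, hK⟩, rfl⟩

theorem nonempty (h : IsProfile K H Q) {γ : ℝ} (hγ : 0 ≤ γ) :
    (H '' {τ | 0 ≤ τ ∧ K τ ≤ γ}).Nonempty :=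
  ⟨_, 0, ⟨le_rfl, by rwa [h.zeroK]⟩, rfl⟩

theorem exists_of_lt_hitLimit (h : IsProfile K H Q) {γ y : ℝ} (hγ : 0 ≤ γ)
    (hy : y < hitLimit K H γ) : ∃ τ, 0 ≤ τ ∧ K τ ≤ γ ∧ y < H τ := by
  obtain ⟨_, ⟨τ, hτ, rfl⟩, hlt⟩ := exists_lt_of_lt_csSup (h.nonempty hγ) hy
  exact ⟨τ, hτ.1, hτ.2, hlt⟩

/-- Either all files fit into the partition, or slightly longer windows do not fit. -/
theorem of_hitLimit_lt (h : IsProfile K H Q) {γ y : ℝ} (hγ : 0 ≤ γ) (hy : hitLimit K H γ < y) :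
    (Q < y ∧ ∀ τ, 0 ≤ τ → K τ ≤ γ) ∨ ∃ τ, 0 < τ ∧ γ < K τ ∧ H τ < y := by
  by_cases hall : ∀ τ, 0 ≤ τ → K τ ≤ γ
  · refine Or.inl ⟨lt_of_le_of_lt ?_ hy, hall⟩
    exact le_of_tendsto h.tendstoH ((eventually_ge_atTop 0).mono fun τ hτ =>
      h.le_hitLimit hτ (hall τ hτ))
  · right
    push Not at hall
    obtain ⟨τ₁, hτ₁, hK₁⟩ := hall
    obtain ⟨σ, hσ, hKσ⟩ := intermediate_value_Icc hτ₁
      (h.contK.mono Set.Icc_subset_Ici_self) ⟨h.zeroK.le.trans hγ, hK₁.le⟩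
    have hHσ : H σ < y := (h.le_hitLimit hσ.1 hKσ.le).trans_lt hy
    have hc : Tendsto H (𝓝[>] σ) (𝓝 (H σ)) :=
      (h.contH σ hσ.1).mono_left (nhdsWithin_mono _ fun x hx => hσ.1.trans (le_of_lt hx))
    obtain ⟨τ, hτy, hτ⟩ := ((hc.eventually_lt_const hHσ).and self_mem_nhdsWithin).exists
    have hτ' : σ < τ := hτ
    refine ⟨τ, hσ.1.trans_lt hτ', ?_, hτy⟩
    rw [← hKσ]
    exact h.strictMonoK hσ.1 (hσ.1.trans hτ'.le : (0 : ℝ) ≤ τ) hτ'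

theorem upperSemicontinuousOn_hitLimit (h : IsProfile K H Q) :
    UpperSemicontinuousOn (hitLimit K H) (Set.Ici 0) := by
  intro γ hγ y hy
  rcases h.of_hitLimit_lt hγ hy with ⟨hQ, -⟩ | ⟨τ, hτ, hK, hH⟩
  · filter_upwards [self_mem_nhdsWithin] with γ' hγ'
    refine lt_of_le_of_lt (csSup_le (h.nonempty hγ') ?_) hQ
    rintro _ ⟨τ, hτ, rfl⟩
    exact h.le hτ.1
  · filter_upwards [self_mem_nhdsWithin, mem_nhdsWithin_of_mem_nhds (Iio_mem_nhds hK)] with γ' hγ' hlt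
    refine lt_of_le_of_lt (csSup_le (h.nonempty hγ') ?_) hH
    rintro _ ⟨σ, hσ, rfl⟩
    refine h.monoH hσ.1 hτ.le (le_of_lt ?_)
    exact (h.strictMonoK.lt_iff_lt hσ.1 hτ.le).1 (hσ.2.trans_lt hlt)

/-- Slightly shorter windows fit strictly into the partition. -/
theorem exists_pos_of_lt_hitLimit (h : IsProfile K H Q) {γ y : ℝ} (hγ : 0 ≤ γ) (hy0 : 0 ≤ y)
    (hy : y < hitLimit K H γ) : ∃ τ, 0 < τ ∧ K τ < γ ∧ y < H τ := by
  obtain ⟨σ, hσ, hKσ, hyσ⟩ := h.exists_of_lt_hitLimit hγ hy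
  have hσ0 : 0 < σ := by
    refine hσ.lt_of_ne fun h0 => ?_
    rw [← h0, h.zeroH] at hyσ
    exact hyσ.not_ge hy0
  have hc : Tendsto H (𝓝[<] σ) (𝓝 (H σ)) :=
    ((h.contH.continuousAt (Ici_mem_nhds hσ0)).tendsto).mono_left nhdsWithin_le_nhds
  obtain ⟨τ, ⟨hτy, hτσ⟩, hτ0⟩ := ((hc.eventually_const_lt hyσ).and self_mem_nhdsWithin |>.and
    (mem_nhdsWithin_of_mem_nhds (Ioi_mem_nhds hσ0))).exists
  have hτσ' : τ < σ := hτσ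
  have hτ0' : 0 < τ := hτ0
  exact ⟨τ, hτ0', (h.strictMonoK hτ0'.le hσ hτσ').trans_le hKσ, hτy⟩

/-- If windows of length `τ * n` asymptotically behave as the profile says, then the steady-state
hit probability of the partition converges. -/
theorem tendsto_hitLimit (h : IsProfile K H Q) {γ B : ℝ} (hγ : 0 ≤ γ) {g C N : ℕ → ℝ}
    {S A : ℕ → ℕ → ℝ} (hC : Tendsto (fun n => C n / n) atTop (𝓝 γ))
    (hN0 : ∀ n, 0 ≤ N n) (hN : ∀ n, N n ≤ B * n)
    (hS : ∀ τ : ℝ, 0 < τ → Tendsto (fun n : ℕ => S n ⌊τ * n⌋₊ / n) atTop (𝓝 (K τ)))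
    (hA : ∀ τ : ℝ, 0 < τ → Tendsto (fun n : ℕ => A n ⌊τ * n⌋₊) atTop (𝓝 (H τ)))
    (hg0 : ∀ n, 0 < n → 0 ≤ g n) (hgQ : ∀ n, 0 < n → g n ≤ Q)
    (hupper : ∀ n, 0 < n → ∀ m δ, 0 < δ → C n + δ ≤ S n m → g n ≤ A n m + N n / δ ^ 2)
    (hlower : ∀ n, 0 < n → ∀ m δ, 0 < δ → S n m + δ ≤ C n → A n m - N n / δ ^ 2 ≤ g n) :
    Tendsto g atTop (𝓝 (hitLimit K H γ)) := by
  have herr : ∀ ε : ℝ, 0 < ε → Tendsto (fun n : ℕ => N n / (ε * n) ^ 2) atTop (𝓝 0) := by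
    intro ε hε
    have hB : Tendsto (fun n : ℕ => B / ε ^ 2 * (1 / (n : ℝ))) atTop (𝓝 0) := by
      simpa using tendsto_one_div_atTop_nhds_zero_nat.const_mul (B / ε ^ 2)
    refine squeeze_zero' (Eventually.of_forall fun n => div_nonneg (hN0 n) (sq_nonneg _)) ?_ hB
    filter_upwards [eventually_gt_atTop 0] with n hn
    have hn' : (0 : ℝ) < n := by exact_mod_cast hn
    calc N n / (ε * n) ^ 2 ≤ B * n / (ε * n) ^ 2 := by gcongr; exact hN n
      _ = B / ε ^ 2 * (1 / (n : ℝ)) := by field_simp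
  refine tendsto_order.2 ⟨fun y hy => ?_, fun y hy => ?_⟩
  · rcases lt_or_ge y 0 with hy0 | hy0
    · filter_upwards [eventually_gt_atTop 0] with n hn using hy0.trans_le (hg0 n hn)
    obtain ⟨τ, hτ, hK, hH⟩ := h.exists_pos_of_lt_hitLimit hγ hy0 hy
    obtain ⟨ε, hε, hεγ⟩ : ∃ ε, 0 < ε ∧ K τ + ε < γ := ⟨(γ - K τ) / 2, by linarith, by linarith⟩
    have h1 := ((hS τ hτ).add_const ε).eventually_lt hC hεγ
    have h2 : ∀ᶠ n : ℕ in atTop, y < A n ⌊τ * n⌋₊ - N n / (ε * n) ^ 2 :=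
      ((hA τ hτ).sub (herr ε hε)).eventually_const_lt (by simpa using hH)
    filter_upwards [h1, h2, eventually_gt_atTop 0] with n hn1 hn2 hn
    have hn' : (0 : ℝ) < n := by exact_mod_cast hn
    refine hn2.trans_le (hlower n hn _ _ (by positivity) ?_)
    have := (mul_lt_mul_of_pos_right hn1 hn').le
    rwa [add_mul, div_mul_cancel₀ _ hn'.ne', div_mul_cancel₀ _ hn'.ne'] at this
  · rcases h.of_hitLimit_lt hγ hy with ⟨hQ, -⟩ | ⟨τ, hτ, hK, hH⟩
    · filter_upwards [eventually_gt_atTop 0] with n hn using (hgQ n hn).trans_lt hQ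
    obtain ⟨ε, hε, hεγ⟩ : ∃ ε, 0 < ε ∧ γ + ε < K τ := ⟨(K τ - γ) / 2, by linarith, by linarith⟩
    have h1 := (hC.add_const ε).eventually_lt (hS τ hτ) hεγ
    have h2 : ∀ᶠ n : ℕ in atTop, A n ⌊τ * n⌋₊ + N n / (ε * n) ^ 2 < y :=
      ((hA τ hτ).add (herr ε hε)).eventually_lt_const (by simpa using hH)
    filter_upwards [h1, h2, eventually_gt_atTop 0] with n hn1 hn2 hn
    have hn' : (0 : ℝ) < n := by exact_mod_cast hn
    refine (hupper n hn _ _ (by positivity) ?_).trans_lt hn2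
    have := (mul_lt_mul_of_pos_right hn1 hn').le
    rwa [add_mul, div_mul_cancel₀ _ hn'.ne', div_mul_cancel₀ _ hn'.ne'] at this

end IsProfile

/-! ### Popularity distributions and their densities -/

section Step

variable {F : ℝ → ℝ}

/-- The slopes of a function over grid intervals shrinking to `x` converge to its derivative. -/
theorem tendsto_mul_floor_increment {d x : ℝ} (hx : 0 ≤ x) (h : HasDerivAt F d x) :
    Tendsto (fun N : ℕ => (N : ℝ) * (F ((⌊N * x⌋₊ + 1 : ℝ) / N) - F ((⌊N * x⌋₊ : ℝ) / N)))
      atTop (𝓝 d) := by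
  have hrem : ∀ u : ℕ → ℝ, (∀ᶠ N : ℕ in atTop, |(N : ℝ) * (u N - x)| ≤ 1) →
      Tendsto (fun N : ℕ => (N : ℝ) * (F (u N) - F x - d * (u N - x))) atTop (𝓝 0) := by
    intro u hu
    have hux : Tendsto u atTop (𝓝 x) := by
      rw [tendsto_iff_dist_tendsto_zero]
      refine squeeze_zero' (Eventually.of_forall fun _ => dist_nonneg) ?_
        tendsto_one_div_atTop_nhds_zero_nat
      filter_upwards [hu, eventually_gt_atTop 0] with N hN hN0
      have hN' : (0 : ℝ) < N := by exact_mod_cast hN0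
      rw [Real.dist_eq, le_div_iff₀ hN', mul_comm]
      rwa [abs_mul, abs_of_pos hN'] at hN
    have ho := (hasDerivAt_iff_isLittleO.1 h).comp_tendsto hux
    rw [Metric.tendsto_atTop']
    intro ε hε
    have hb := ho.bound (half_pos hε)
    obtain ⟨M, hM⟩ := eventually_atTop.1 (hb.and hu)
    refine ⟨M, fun N hN => ?_⟩
    obtain ⟨h1, h2⟩ := hM N hN.le
    rw [abs_mul, Nat.abs_cast] at h2
    simp only [Function.comp_apply, smul_eq_mul, Real.norm_eq_abs] at h1
    rw [dist_zero_right, Real.norm_eq_abs, abs_mul, Nat.abs_cast, mul_comm d]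
    calc (N : ℝ) * |F (u N) - F x - (u N - x) * d| ≤ N * (ε / 2 * |u N - x|) := by gcongr
      _ = ε / 2 * (N * |u N - x|) := by ring
      _ ≤ ε / 2 * 1 := by gcongr
      _ < ε := by linarith
  have h1 := hrem (fun N => (⌊N * x⌋₊ + 1 : ℝ) / N) (by
    filter_upwards [eventually_gt_atTop 0] with N hN
    have hN' : (0 : ℝ) < N := by exact_mod_cast hN
    rw [mul_sub, mul_div_cancel₀ _ hN'.ne', abs_le]
    constructor <;> linarith [Nat.floor_le (by positivity : 0 ≤ N * x), Nat.lt_floor_add_one (N * x)])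
  have h2 := hrem (fun N => (⌊N * x⌋₊ : ℝ) / N) (by
    filter_upwards [eventually_gt_atTop 0] with N hN
    have hN' : (0 : ℝ) < N := by exact_mod_cast hN
    rw [mul_sub, mul_div_cancel₀ _ hN'.ne', abs_le]
    constructor <;> linarith [Nat.floor_le (by positivity : 0 ≤ N * x), Nat.lt_floor_add_one (N * x)])
  have h3 := (h1.sub h2).add_const d
  rw [sub_zero, zero_add] at h3
  refine h3.congr' ?_
  filter_upwards [eventually_gt_atTop 0] with N hN
  have hN' : (0 : ℝ) < N := by exact_mod_cast hN
  field_simp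
  ring

theorem measurable_comp_floor (φ : ℕ → ℝ) (N : ℕ) : Measurable fun x : ℝ => φ ⌊N * x⌋₊ :=
  measurable_from_nat.comp (Nat.measurable_floor.comp (measurable_const.mul measurable_id))

theorem sum_range_eq_integral (φ : ℕ → ℝ) {N : ℕ} (hN : 0 < N) :
    (∑ i ∈ Finset.range N, φ i) / N = ∫ x in (0 : ℝ)..1, φ ⌊N * x⌋₊ := by
  have hN' : (0 : ℝ) < N := by exact_mod_cast hN
  have hfl : ∀ i : ℕ, ∀ᵐ x : ℝ, x ∈ Set.uIoc ((i : ℝ) / N) (((i + 1 : ℕ) : ℝ) / N) →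
      φ ⌊N * x⌋₊ = φ i := by
    intro i
    have hne : ∀ᵐ x : ℝ, x ≠ ((i + 1 : ℕ) : ℝ) / N := by
      simpa using (Set.countable_singleton (((i + 1 : ℕ) : ℝ) / N)).ae_notMem MeasureTheory.volume
    filter_upwards [hne] with x hx hmem
    rw [Set.uIoc_of_le (by gcongr; simp)] at hmem
    have h1 := hmem.1
    have h2 := lt_of_le_of_ne hmem.2 hx
    rw [div_lt_iff₀ hN'] at h1
    rw [lt_div_iff₀ hN'] at h2
    congr 1
    rw [Nat.floor_eq_iff (by nlinarith [Nat.cast_nonneg (α := ℝ) i])]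
    push_cast at h2
    constructor <;> nlinarith
  have h := intervalIntegral.sum_integral_adjacent_intervals (f := fun x : ℝ => φ ⌊N * x⌋₊)
    (μ := MeasureTheory.volume) (a := fun i : ℕ => (i : ℝ) / N) (n := N) fun i _ => by
      refine (intervalIntegrable_const (c := φ i)).congr_ae ?_
      rw [Filter.EventuallyEq, MeasureTheory.ae_restrict_iff' measurableSet_uIoc]
      exact (hfl i).mono fun x hx hmem => (hx hmem).symm
  rw [Nat.cast_zero, zero_div, div_self hN'.ne'] at h
  rw [← h, Finset.sum_div]
  refine Finset.sum_congr rfl fun i _ => ?_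
  rw [intervalIntegral.integral_congr_ae (hfl i), intervalIntegral.integral_const, smul_eq_mul]
  push_cast
  field_simp
  ring

end Step

theorem sum_popularity {F : ℝ → ℝ} (hF : IsPopularityDistribution F) {N : ℕ} (hN : 0 < N) :
    ∑ i, popularity F N i = 1 := by
  have hN' : (N : ℝ) ≠ 0 := by exact_mod_cast hN.ne'
  have h := Finset.sum_range_sub (fun i : ℕ => F ((i : ℝ) / N)) N
  rw [Nat.cast_zero, zero_div, div_self hN', hF.zero, hF.one, sub_zero] at h
  rw [← h, Finset.sum_range]
  simp [popularity]

namespace IsPopularityDistribution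

variable {F : ℝ → ℝ} (hF : IsPopularityDistribution F)
include hF

theorem increment_mem {N i : ℕ} (hi : i < N) :
    F ((i + 1 : ℝ) / N) - F ((i : ℝ) / N) ∈ Set.Icc (0 : ℝ) 1 := by
  have hN : (0 : ℝ) < N := by exact_mod_cast Nat.zero_lt_of_lt hi
  have hi' : (i : ℝ) + 1 ≤ N := by exact_mod_cast hi
  have h1 : (i : ℝ) / N ∈ Set.Icc (0 : ℝ) 1 :=
    ⟨by positivity, (div_le_one hN).2 (by linarith)⟩
  have h2 : (i + 1 : ℝ) / N ∈ Set.Icc (0 : ℝ) 1 :=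
    ⟨by positivity, (div_le_one hN).2 hi'⟩
  have h3 := hF.mono h1 h2 (by gcongr; linarith)
  have h4 := hF.mono (by simp) h1 h1.1
  have h5 := hF.mono h2 (by simp) h2.2
  rw [hF.zero] at h4
  rw [hF.one] at h5
  constructor <;> linarith

theorem popularity_nonneg {N : ℕ} (i : Fin N) : 0 ≤ popularity F N i :=
  (hF.increment_mem i.2).1

theorem ae_hasDerivAt : ∀ᵐ x : ℝ, x ∈ Set.Ioo (0 : ℝ) 1 → HasDerivAt F (deriv F x) x := by
  obtain ⟨S, hS, hd, -⟩ := hF.contDiff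
  filter_upwards [hS.ae_notMem MeasureTheory.volume] with x hx hmem
  exact (hd x ⟨hmem, hx⟩).hasDerivAt

theorem deriv_nonneg {x : ℝ} (hx : x ∈ Set.Ioo (0 : ℝ) 1) : 0 ≤ deriv F x := by
  rw [← derivWithin_of_mem_nhds (Icc_mem_nhds hx.1 hx.2)]
  exact hF.mono.derivWithin_nonneg

theorem intervalIntegrable_deriv : IntervalIntegrable (deriv F) MeasureTheory.volume 0 1 :=
  MonotoneOn.intervalIntegrable_deriv (by rw [Set.uIcc_of_le zero_le_one]; exact hF.mono)

theorem integral_deriv : ∫ x in (0 : ℝ)..1, deriv F x = 1 := by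
  obtain ⟨S, hS, hd, -⟩ := hF.contDiff
  rw [MeasureTheory.integral_eq_of_hasDerivAt_off_countable_of_le F (deriv F) zero_le_one hS hF.cont
    (fun x hx => (hd x hx).hasDerivAt) hF.intervalIntegrable_deriv, hF.zero, hF.one, sub_zero]

end IsPopularityDistribution

/-- An almost-everywhere statement on `(0, 1]` need only be checked on `(0, 1)`. -/
theorem ae_uIoc_of_ae_Ioo {p : ℝ → Prop} (h : ∀ᵐ x : ℝ, x ∈ Set.Ioo (0 : ℝ) 1 → p x) :
    ∀ᵐ x : ℝ, x ∈ Set.uIoc (0 : ℝ) 1 → p x := by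
  have hne : ∀ᵐ x : ℝ, x ≠ 1 := by
    simpa using (Set.countable_singleton (1 : ℝ)).ae_notMem MeasureTheory.volume
  filter_upwards [h, hne] with x hx hx1 hmem
  rw [Set.uIoc_of_le zero_le_one] at hmem
  exact hx ⟨hmem.1, lt_of_le_of_ne hmem.2 hx1⟩

/-! ### The profile of a popularity distribution -/

/-- The asymptotic proportion of the files that are requested during a window in which each file
is requested `s` times on average. -/
noncomputable def distinctLimit (F : ℝ → ℝ) (s : ℝ) : ℝ :=
  ∫ x in (0 : ℝ)..1, (1 - Real.exp (-(s * deriv F x)))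

/-- The asymptotic probability that a file is requested during such a window, the file being
chosen according to its popularity. -/
noncomputable def repeatLimit (F : ℝ → ℝ) (s : ℝ) : ℝ :=
  ∫ x in (0 : ℝ)..1, deriv F x * (1 - Real.exp (-(s * deriv F x)))

theorem one_sub_exp_mem {y : ℝ} (hy : 0 ≤ y) : 1 - Real.exp (-y) ∈ Set.Icc (0 : ℝ) 1 :=
  ⟨sub_nonneg.2 (Real.exp_le_one_iff.2 (by linarith)), sub_le_self _ (Real.exp_pos _).le⟩

namespace IsPopularityDistribution

variable {F : ℝ → ℝ} (hF : IsPopularityDistribution F)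
include hF

theorem ae_deriv_nonneg : ∀ᵐ x ∂(MeasureTheory.volume.restrict (Set.Ioc (0 : ℝ) 1)),
    0 ≤ deriv F x := by
  rw [MeasureTheory.ae_restrict_iff' measurableSet_Ioc]
  have := ae_uIoc_of_ae_Ioo (p := fun x => 0 ≤ deriv F x)
    (Eventually.of_forall fun x hx => hF.deriv_nonneg hx)
  rwa [Set.uIoc_of_le zero_le_one] at this

theorem integrable_deriv :
    MeasureTheory.Integrable (deriv F) (MeasureTheory.volume.restrict (Set.Ioc (0 : ℝ) 1)) :=
  (intervalIntegrable_iff_integrableOn_Ioc_of_le zero_le_one).1 hF.intervalIntegrable_deriv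

omit hF in
theorem measurable_one_sub_exp (s : ℝ) :
    Measurable fun x => 1 - Real.exp (-(s * deriv F x)) :=
  measurable_const.sub (Real.measurable_exp.comp ((measurable_deriv F).const_mul s).neg)

theorem integrable_one_sub_exp {s : ℝ} (hs : 0 ≤ s) :
    MeasureTheory.Integrable (fun x => 1 - Real.exp (-(s * deriv F x)))
      (MeasureTheory.volume.restrict (Set.Ioc (0 : ℝ) 1)) := by
  refine MeasureTheory.Integrable.mono' (MeasureTheory.integrable_const (1 : ℝ))
    (measurable_one_sub_exp s).aestronglyMeasurable ?_
  filter_upwards [hF.ae_deriv_nonneg] with x hx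
  have := one_sub_exp_mem (mul_nonneg hs hx)
  rw [Real.norm_eq_abs, abs_of_nonneg this.1]
  exact this.2

theorem ae_norm_mul_le {s : ℝ} (hs : 0 ≤ s) :
    ∀ᵐ x ∂(MeasureTheory.volume.restrict (Set.Ioc (0 : ℝ) 1)),
      ‖deriv F x * (1 - Real.exp (-(s * deriv F x)))‖ ≤ deriv F x := by
  filter_upwards [hF.ae_deriv_nonneg] with x hx
  have := one_sub_exp_mem (mul_nonneg hs hx)
  rw [Real.norm_eq_abs, abs_of_nonneg (mul_nonneg hx this.1)]
  exact mul_le_of_le_one_right hx this.2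

omit hF in
theorem aestronglyMeasurable_mul (s : ℝ) :
    MeasureTheory.AEStronglyMeasurable (fun x => deriv F x * (1 - Real.exp (-(s * deriv F x))))
      (MeasureTheory.volume.restrict (Set.Ioc (0 : ℝ) 1)) :=
  ((measurable_deriv F).mul (measurable_one_sub_exp s)).aestronglyMeasurable

theorem integrable_mul {s : ℝ} (hs : 0 ≤ s) :
    MeasureTheory.Integrable (fun x => deriv F x * (1 - Real.exp (-(s * deriv F x))))
      (MeasureTheory.volume.restrict (Set.Ioc (0 : ℝ) 1)) :=
  hF.integrable_deriv.mono' (aestronglyMeasurable_mul s) (hF.ae_norm_mul_le hs)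

theorem strictMonoOn_distinctLimit : StrictMonoOn (distinctLimit F) (Set.Ici 0) := by
  intro s hs t ht hst
  have hs' : 0 ≤ s := hs
  have ht' : 0 ≤ t := ht
  simp only [distinctLimit, intervalIntegral.integral_of_le zero_le_one]
  have hle : (fun x => 1 - Real.exp (-(s * deriv F x)))
      ≤ᵐ[MeasureTheory.volume.restrict (Set.Ioc (0 : ℝ) 1)]
      fun x => 1 - Real.exp (-(t * deriv F x)) := by
    filter_upwards [hF.ae_deriv_nonneg] with x hx
    gcongr
  refine lt_of_le_of_ne (MeasureTheory.integral_mono_ae (hF.integrable_one_sub_exp hs')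
    (hF.integrable_one_sub_exp ht') hle) fun heq => ?_
  rw [MeasureTheory.integral_eq_iff_of_ae_le (hF.integrable_one_sub_exp hs')
    (hF.integrable_one_sub_exp ht') hle] at heq
  have hzero : deriv F =ᵐ[MeasureTheory.volume.restrict (Set.Ioc (0 : ℝ) 1)] 0 := by
    filter_upwards [heq] with x hx
    have h1 : s * deriv F x = t * deriv F x := by
      have := Real.exp_injective (sub_right_injective hx)
      linarith
    have h2 : (t - s) * deriv F x = 0 := by linarith
    exact (mul_eq_zero.1 h2).resolve_left (by linarith)
  have h1 := hF.integral_deriv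
  rw [intervalIntegral.integral_of_le zero_le_one, MeasureTheory.integral_congr_ae hzero] at h1
  simp at h1

theorem continuousOn_distinctLimit : ContinuousOn (distinctLimit F) (Set.Ici 0) := by
  change ContinuousOn (fun s => ∫ x in (0 : ℝ)..1, (1 - Real.exp (-(s * deriv F x)))) _
  simp only [intervalIntegral.integral_of_le zero_le_one]
  refine MeasureTheory.continuousOn_of_dominated (bound := fun _ => 1)
    (fun s _ => (measurable_one_sub_exp s).aestronglyMeasurable) (fun s hs => ?_)
    (MeasureTheory.integrable_const _) (Eventually.of_forall fun x => by fun_prop)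
  filter_upwards [hF.ae_deriv_nonneg] with x hx
  have := one_sub_exp_mem (mul_nonneg hs hx)
  rw [Real.norm_eq_abs, abs_of_nonneg this.1]
  exact this.2

/-- The functions of a single catalogue, each file being requested once per unit of time on
average. -/
theorem isProfile : IsProfile (distinctLimit F) (repeatLimit F) 1 where
  contK := hF.continuousOn_distinctLimit
  strictMonoK := hF.strictMonoOn_distinctLimit
  zeroK := by simp [distinctLimit]
  contH := by
    change ContinuousOn (fun s => ∫ x in (0 : ℝ)..1, deriv F x * (1 - Real.exp (-(s * deriv F x)))) _
    simp only [intervalIntegral.integral_of_le zero_le_one]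
    exact MeasureTheory.continuousOn_of_dominated (bound := deriv F)
      (fun s _ => aestronglyMeasurable_mul s) (fun s hs => hF.ae_norm_mul_le hs)
      hF.integrable_deriv (Eventually.of_forall fun x => by fun_prop)
  monoH := by
    intro s hs t ht hst
    simp only [repeatLimit, intervalIntegral.integral_of_le zero_le_one]
    refine MeasureTheory.integral_mono_ae (hF.integrable_mul hs) (hF.integrable_mul ht) ?_
    filter_upwards [hF.ae_deriv_nonneg] with x hx
    gcongr
  zeroH := by simp [repeatLimit]
  tendstoH := by
    rw [← hF.integral_deriv]
    change Tendsto (fun s => ∫ x in (0 : ℝ)..1, deriv F x * (1 - Real.exp (-(s * deriv F x)))) _ _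
    simp only [intervalIntegral.integral_of_le zero_le_one]
    refine MeasureTheory.tendsto_integral_filter_of_dominated_convergence (deriv F)
      (Eventually.of_forall fun s => aestronglyMeasurable_mul s)
      ((eventually_ge_atTop 0).mono fun s hs => hF.ae_norm_mul_le hs) hF.integrable_deriv ?_
    filter_upwards [hF.ae_deriv_nonneg] with x hx
    rcases hx.eq_or_lt with h0 | h0
    · simp [← h0]
    · have h1 : Tendsto (fun s => Real.exp (-(s * deriv F x))) atTop (𝓝 0) :=
        Real.tendsto_exp_neg_atTop_nhds_zero.comp (tendsto_id.atTop_mul_const h0)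
      simpa using (h1.const_sub 1).const_mul (deriv F x)

end IsPopularityDistribution

theorem IsProfile.scale {K H : ℝ → ℝ} {Q : ℝ} (h : IsProfile K H Q) {a b c : ℝ} (ha : 0 < a)
    (hb : 0 < b) (hc : 0 < c) :
    IsProfile (fun τ => b * K (τ * c)) (fun τ => a * H (τ * c)) (a * Q) where
  contK := continuousOn_const.mul (h.contK.comp (by fun_prop) fun τ hτ => mul_nonneg hτ hc.le)
  strictMonoK := fun s hs t ht hst => mul_lt_mul_of_pos_left (h.strictMonoK (mul_nonneg hs hc.le)
    (mul_nonneg ht hc.le) (mul_lt_mul_of_pos_right hst hc)) hb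
  zeroK := by simp [h.zeroK]
  contH := continuousOn_const.mul (h.contH.comp (by fun_prop) fun τ hτ => mul_nonneg hτ hc.le)
  monoH := fun s hs t ht hst => mul_le_mul_of_nonneg_left (h.monoH (mul_nonneg hs hc.le)
    (mul_nonneg ht hc.le) (mul_le_mul_of_nonneg_right hst hc.le)) ha.le
  zeroH := by simp [h.zeroH]
  tendstoH := (h.tendstoH.comp (tendsto_id.atTop_mul_const hc)).const_mul a

/-! ### Convergence to the profile -/

theorem mul_one_sub_pow_le {Q : ℝ} (h0 : 0 ≤ Q) (h1 : Q ≤ 1) (m : ℕ) :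
    (m + 1) * (Q * (1 - Q) ^ m) ≤ 2 := by
  have hp : 0 ≤ (1 - Q) ^ m := pow_nonneg (by linarith) m
  have hp1 : (1 - Q) ^ m ≤ 1 := pow_le_one₀ (by linarith) (by linarith)
  have h2 : (1 + m * Q) * (1 - Q) ^ m ≤ 1 := by
    calc (1 + m * Q) * (1 - Q) ^ m ≤ (1 + Q) ^ m * (1 - Q) ^ m := by
          gcongr
          exact one_add_mul_le_pow (by linarith) m
      _ = (1 - Q ^ 2) ^ m := by rw [← mul_pow]; ring
      _ ≤ 1 := pow_le_one₀ (by nlinarith) (by nlinarith)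
  nlinarith [mul_le_one₀ h1 hp hp1]

theorem tendsto_one_sub_pow_floor {Q : ℕ → ℝ} {d τ : ℝ} (hQ : ∀ n, Q n ≤ 1) (hτ : 0 ≤ τ)
    (h : Tendsto (fun n : ℕ => (n : ℝ) * Q n) atTop (𝓝 d)) :
    Tendsto (fun n : ℕ => (1 - Q n) ^ ⌊τ * n⌋₊) atTop (𝓝 (Real.exp (-(τ * d)))) := by
  have h1 : Tendsto (fun n : ℕ => (1 + -Q n) ^ n) atTop (𝓝 (Real.exp (-d))) :=
    Real.tendsto_one_add_pow_exp_of_tendsto (by simpa using h.neg)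
  have h2 : Tendsto (fun n : ℕ => (⌊τ * n⌋₊ : ℝ) / n) atTop (𝓝 τ) :=
    (tendsto_nat_floor_mul_div_atTop hτ).comp tendsto_natCast_atTop_atTop
  have h3 := h1.rpow h2 (Or.inl (Real.exp_pos _).ne')
  rw [← Real.exp_mul, neg_mul, mul_comm] at h3
  refine h3.congr' ?_
  filter_upwards [eventually_gt_atTop 0] with n hn
  have hn' : (n : ℝ) ≠ 0 := by exact_mod_cast hn.ne'
  have h0 : 0 ≤ 1 - Q n := sub_nonneg.2 (hQ n)
  rw [← sub_eq_add_neg, ← Real.rpow_natCast, ← Real.rpow_mul h0, mul_div_cancel₀ _ hn',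
    Real.rpow_natCast]

namespace IsPopularityDistribution

variable {F : ℝ → ℝ} (hF : IsPopularityDistribution F)
include hF

/-- Dominated convergence for sums over the files of a catalogue. -/
theorem tendsto_sum_popularity {b : ℕ} (hb : 0 < b) {ψ : ℕ → ℝ → ℝ} {Ψ : ℝ → ℝ} {B : ℝ}
    (hbound : ∀ᶠ n in atTop, ∀ y ∈ Set.Icc (0 : ℝ) 1, |ψ n y| ≤ B)
    (hlim : ∀ y : ℕ → ℝ, ∀ d, (∀ n, y n ∈ Set.Icc (0 : ℝ) 1) →
      Tendsto (fun n : ℕ => ((b * n : ℕ) : ℝ) * y n) atTop (𝓝 d) →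
      Tendsto (fun n => ψ n (y n)) atTop (𝓝 (Ψ d))) :
    Tendsto (fun n : ℕ => (∑ i, ψ n (popularity F (b * n) i)) / ((b * n : ℕ) : ℝ)) atTop
      (𝓝 (∫ x in (0 : ℝ)..1, Ψ (deriv F x))) := by
  have hpos : ∀ n, 0 < n → 0 < b * n := fun n hn => Nat.mul_pos hb hn
  have hfl : ∀ n : ℕ, 0 < n → ∀ x ∈ Set.Ioo (0 : ℝ) 1, ⌊((b * n : ℕ) : ℝ) * x⌋₊ < b * n := by
    intro n hn x hx
    have h0 : (0 : ℝ) < (b * n : ℕ) := by exact_mod_cast hpos n hn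
    rw [Nat.floor_lt (mul_nonneg h0.le hx.1.le)]
    nlinarith [hx.2]
  set φ : ℕ → ℕ → ℝ := fun n i => ψ n
    (F ((i + 1 : ℝ) / ((b * n : ℕ) : ℝ)) - F ((i : ℝ) / ((b * n : ℕ) : ℝ))) with hφ
  have key : Tendsto (fun n : ℕ => ∫ x in (0 : ℝ)..1, φ n ⌊((b * n : ℕ) : ℝ) * x⌋₊) atTop
      (𝓝 (∫ x in (0 : ℝ)..1, Ψ (deriv F x))) := by
    refine intervalIntegral.tendsto_integral_filter_of_dominated_convergence (fun _ => B) ?_ ?_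
      intervalIntegrable_const ?_
    · exact Eventually.of_forall fun n => (measurable_comp_floor (φ n) _).aestronglyMeasurable
    · filter_upwards [hbound, eventually_gt_atTop 0] with n hn hn0
      exact ae_uIoc_of_ae_Ioo (Eventually.of_forall fun x hx =>
        hn _ (hF.increment_mem (hfl n hn0 x hx)))
    · refine ae_uIoc_of_ae_Ioo ?_
      filter_upwards [hF.ae_hasDerivAt] with x hx hmem
      have hd := (tendsto_mul_floor_increment hmem.1.le (hx hmem)).comp
        (tendsto_id.const_mul_atTop' hb : Tendsto (fun n : ℕ => b * n) atTop atTop)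
      refine hlim _ _ (fun n => ?_) hd
      rcases Nat.eq_zero_or_pos n with rfl | hn0
      · simp
      · exact hF.increment_mem (hfl n hn0 x hmem)
  refine key.congr' ?_
  filter_upwards [eventually_gt_atTop 0] with n hn
  rw [← sum_range_eq_integral (φ n) (hpos n hn), Finset.sum_range]
  rfl

variable {a : ℝ} {b : ℕ} {τ : ℝ}

omit hF in
theorem tendsto_mul_of_tendsto (hb : 0 < b) {y : ℕ → ℝ} {d : ℝ}
    (hd : Tendsto (fun n : ℕ => ((b * n : ℕ) : ℝ) * y n) atTop (𝓝 d)) :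
    Tendsto (fun n : ℕ => (n : ℝ) * (a * y n)) atTop (𝓝 (a / b * d)) := by
  have hb' : (b : ℝ) ≠ 0 := by exact_mod_cast hb.ne'
  refine (hd.const_mul (a / b)).congr fun n => ?_
  push_cast
  field_simp

/-- The number of distinct files requested from a catalogue of `b * n` files that receives the
fraction `a` of the requests. -/
theorem tendsto_distinctMean (ha : 0 ≤ a) (ha1 : a ≤ 1) (hb : 0 < b) (hτ : 0 < τ) :
    Tendsto (fun n : ℕ => distinctMean (fun i => a * popularity F (b * n) i) ⌊τ * n⌋₊ / n) atTop
      (𝓝 (b * distinctLimit F (τ * (a / b)))) := by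
  have hb' : (b : ℝ) ≠ 0 := by exact_mod_cast hb.ne'
  have h := hF.tendsto_sum_popularity hb (B := 1)
    (ψ := fun n y => 1 - (1 - a * y) ^ ⌊τ * n⌋₊)
    (Ψ := fun d => 1 - Real.exp (-(τ * (a / b) * d))) (Eventually.of_forall fun n y hy => ?_) ?_
  · refine (h.const_mul (b : ℝ)).congr fun n => ?_
    rw [distinctMean]
    push_cast
    rw [mul_div_assoc', mul_div_mul_left _ _ hb']
  · have h0 : 0 ≤ 1 - a * y := by nlinarith [hy.1, hy.2]
    have h1 : (1 - a * y) ^ ⌊τ * n⌋₊ ≤ 1 := pow_le_one₀ h0 (by nlinarith [hy.1])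
    rw [abs_of_nonneg (by linarith)]
    linarith [pow_nonneg h0 ⌊τ * n⌋₊]
  · intro y d hy hd
    have := tendsto_one_sub_pow_floor (Q := fun n => a * y n)
      (fun n => by nlinarith [(hy n).1, (hy n).2]) hτ.le (tendsto_mul_of_tendsto hb hd)
    simpa only [mul_assoc] using this.const_sub 1

theorem tendsto_repeatProb (ha : 0 ≤ a) (ha1 : a ≤ 1) (hb : 0 < b) (hτ : 0 < τ) :
    Tendsto (fun n : ℕ => repeatProb (fun i => a * popularity F (b * n) i) ⌊τ * n⌋₊) atTop
      (𝓝 (a * repeatLimit F (τ * (a / b)))) := by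
  have hb' : (0 : ℝ) < b := by exact_mod_cast hb
  have h := hF.tendsto_sum_popularity hb (B := 2 * b / τ)
    (ψ := fun n y => ((b * n : ℕ) : ℝ) * (a * y * (1 - a * y) ^ ⌊τ * n⌋₊))
    (Ψ := fun d => a * (d * Real.exp (-(τ * (a / b) * d)))) (Eventually.of_forall fun n y hy => ?_) ?_
  · have heq : a * repeatLimit F (τ * (a / b)) = a -
        ∫ x in (0 : ℝ)..1, a * (deriv F x * Real.exp (-(τ * (a / b) * deriv F x))) := by
      have hint : IntervalIntegrable (fun x => deriv F x * (1 - Real.exp (-(τ * (a / b) * deriv F x))))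
          MeasureTheory.volume 0 1 :=
        (intervalIntegrable_iff_integrableOn_Ioc_of_le zero_le_one).2
          (hF.integrable_mul (by positivity))
      have hsub := intervalIntegral.integral_sub hF.intervalIntegrable_deriv hint
      rw [intervalIntegral.integral_const_mul, show (fun x => deriv F x *
        Real.exp (-(τ * (a / b) * deriv F x))) = fun x => deriv F x - deriv F x *
        (1 - Real.exp (-(τ * (a / b) * deriv F x))) by funext x; ring, hsub, hF.integral_deriv,
        repeatLimit]
      ring
    rw [heq]
    refine (h.const_sub a).congr' ?_
    filter_upwards [eventually_gt_atTop 0] with n hn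
    have hN : ((b * n : ℕ) : ℝ) ≠ 0 := by exact_mod_cast (Nat.mul_pos hb hn).ne'
    rw [← Finset.mul_sum, mul_div_cancel_left₀ _ hN, repeatProb]
    simp only [mul_sub, mul_one]
    rw [Finset.sum_sub_distrib, ← Finset.mul_sum, sum_popularity hF (Nat.mul_pos hb hn), mul_one]
  · have h0 : 0 ≤ a * y := mul_nonneg ha hy.1
    have h1 : a * y ≤ 1 := by nlinarith [hy.1, hy.2]
    have h2 := mul_one_sub_pow_le h0 h1 ⌊τ * n⌋₊
    have h3 : 0 ≤ a * y * (1 - a * y) ^ ⌊τ * n⌋₊ := mul_nonneg h0 (pow_nonneg (by linarith) _)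
    rw [abs_of_nonneg (mul_nonneg (Nat.cast_nonneg _) h3), le_div_iff₀ hτ]
    have h4 : τ * n ≤ ⌊τ * n⌋₊ + 1 := (Nat.lt_floor_add_one _).le
    have h5 := mul_le_mul_of_nonneg_right h4 h3
    push_cast
    nlinarith
  · intro y d hy hd
    have h1 := tendsto_one_sub_pow_floor (Q := fun n => a * y n)
      (fun n => by nlinarith [(hy n).1, (hy n).2]) hτ.le (tendsto_mul_of_tendsto hb hd)
    refine ((hd.mul h1).const_mul a).congr' ?_ |>.trans ?_
    · exact Eventually.of_forall fun n => by ring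
    · rw [mul_assoc τ]

end IsPopularityDistribution

namespace Workload

variable (W : Workload)

/-! ### The two-provider model -/

/-- The total request rate. -/
noncomputable def totalRate : ℝ := ∑ k, (W.rate₀ k + W.rate k)

/-- Probabilities of the files, the common files together having probability `a₀`, and the private
files of provider `k` having probability `a k`. -/
noncomputable def fileMass (a₀ : ℝ) (a : Fin 2 → ℝ) (n : ℕ) : W.File n → ℝ
  | Sum.inl i => a₀ * popularity (W.F₀ 0) (W.b₀ * n) i
  | Sum.inr ⟨j, i⟩ => a j * popularity (W.F j) (W.b j * n) i

/-- The asymptotic number of distinct files for the probabilities `fileMass`. -/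
noncomputable def fileK (a₀ : ℝ) (a : Fin 2 → ℝ) (τ : ℝ) : ℝ :=
  W.b₀ * distinctLimit (W.F₀ 0) (τ * (a₀ / W.b₀)) +
    ∑ j, W.b j * distinctLimit (W.F j) (τ * (a j / W.b j))

/-- The asymptotic probability of a repetition for the probabilities `fileMass`. -/
noncomputable def fileH (a₀ : ℝ) (a : Fin 2 → ℝ) (τ : ℝ) : ℝ :=
  a₀ * repeatLimit (W.F₀ 0) (τ * (a₀ / W.b₀)) +
    ∑ j, a j * repeatLimit (W.F j) (τ * (a j / W.b j))

variable {W} (hb₀ : 0 < W.b₀) (hb : ∀ k, 0 < W.b k)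
  (hF₀ : ∀ k, IsPopularityDistribution (W.F₀ k)) (hF : ∀ k, IsPopularityDistribution (W.F k))

theorem sum_file {n : ℕ} (g : W.File n → ℝ) :
    ∑ v, g v = ∑ i, g (Sum.inl i) + ∑ j, ∑ i, g (Sum.inr ⟨j, i⟩) := by
  rw [Fintype.sum_sum_type, Fintype.sum_sigma]

section FileMass

variable {a₀ : ℝ} {a : Fin 2 → ℝ}

include hb₀ hb hF₀ hF

theorem sum_fileMass {n : ℕ} (hn : 0 < n) : ∑ v, W.fileMass a₀ a n v = a₀ + ∑ j, a j := by
  simp only [sum_file, fileMass, ← Finset.mul_sum, sum_popularity (hF₀ 0) (Nat.mul_pos hb₀ hn),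
    sum_popularity (hF _) (Nat.mul_pos (hb _) hn), mul_one]

theorem tendsto_distinctMean_fileMass (ha₀ : a₀ ∈ Set.Icc (0 : ℝ) 1)
    (ha : ∀ j, a j ∈ Set.Icc (0 : ℝ) 1) {τ : ℝ} (hτ : 0 < τ) :
    Tendsto (fun n : ℕ => distinctMean (W.fileMass a₀ a n) ⌊τ * n⌋₊ / n) atTop
      (𝓝 (W.fileK a₀ a τ)) := by
  have h := ((hF₀ 0).tendsto_distinctMean ha₀.1 ha₀.2 hb₀ hτ).add
    (tendsto_finsetSum Finset.univ fun j _ =>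
      (hF j).tendsto_distinctMean (ha j).1 (ha j).2 (hb j) hτ)
  refine h.congr fun n => ?_
  simp only [distinctMean, sum_file, fileMass, add_div, Finset.sum_div]

theorem tendsto_repeatProb_fileMass (ha₀ : a₀ ∈ Set.Icc (0 : ℝ) 1)
    (ha : ∀ j, a j ∈ Set.Icc (0 : ℝ) 1) {τ : ℝ} (hτ : 0 < τ) :
    Tendsto (fun n : ℕ => repeatProb (W.fileMass a₀ a n) ⌊τ * n⌋₊) atTop
      (𝓝 (W.fileH a₀ a τ)) := by
  have h := ((hF₀ 0).tendsto_repeatProb ha₀.1 ha₀.2 hb₀ hτ).add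
    (tendsto_finsetSum Finset.univ fun j _ =>
      (hF j).tendsto_repeatProb (ha j).1 (ha j).2 (hb j) hτ)
  refine h.congr fun n => ?_
  simp only [repeatProb, sum_file, fileMass]

end FileMass

section RequestLaw

variable (hrate₀ : ∀ k, 0 < W.rate₀ k) (hrate : ∀ k, 0 < W.rate k)

include hrate₀ hrate in
theorem totalRate_pos : 0 < W.totalRate :=
  Finset.sum_pos (fun k _ => add_pos (hrate₀ k) (hrate k)) Finset.univ_nonempty

include hF₀ hF hrate₀ hrate in
theorem requestProb_nonneg (n : ℕ) (r : W.Request n) : 0 ≤ W.requestProb n r := by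
  refine div_nonneg ?_ (totalRate_pos hrate₀ hrate).le
  rcases r with ⟨k, i | i⟩
  · exact mul_nonneg (hrate₀ k).le ((hF₀ k).popularity_nonneg i)
  · exact mul_nonneg (hrate k).le ((hF k).popularity_nonneg i)

include hb₀ hb hF₀ hF hrate₀ hrate in
theorem sum_requestProb {n : ℕ} (hn : 0 < n) : ∑ r, W.requestProb n r = 1 := by
  have h : ∑ r, W.requestRate n r = W.totalRate := by
    rw [Fintype.sum_sigma, totalRate]
    refine Finset.sum_congr rfl fun k _ => ?_
    rw [Fintype.sum_sum_type]
    simp only [requestRate, ← Finset.mul_sum, sum_popularity (hF₀ k) (Nat.mul_pos hb₀ hn),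
      sum_popularity (hF k) (Nat.mul_pos (hb k) hn), mul_one]
  simp only [requestProb, ← Finset.sum_div]
  rw [h]
  exact div_self (totalRate_pos hrate₀ hrate).ne'

/-- The probabilities of the files in a partition, as a sum over the kinds of requests. -/
theorem mass_eq_sum {P : Type} [DecidableEq P] {n : ℕ} (route : W.Request n → P) (p : P)
    (v : W.File n) :
    mass (W.requestProb n) (W.file n) route p v =
      ∑ k, (∑ i, (if route ⟨k, Sum.inl i⟩ = p ∧ Sum.inl i = v then
          W.rate₀ k / W.totalRate * popularity (W.F₀ k) (W.b₀ * n) i else 0) +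
        ∑ i, (if route ⟨k, Sum.inr i⟩ = p ∧ Sum.inr ⟨k, i⟩ = v then
          W.rate k / W.totalRate * popularity (W.F k) (W.b k * n) i else 0)) := by
  rw [mass, Finset.sum_filter, Fintype.sum_sigma]
  refine Finset.sum_congr rfl fun k _ => ?_
  rw [Fintype.sum_sum_type]
  simp only [file, requestProb, requestRate, totalRate, div_mul_eq_mul_div]
  rfl

theorem mass_route₂ (hcommon : W.F₀ 0 = W.F₀ 1) (n : ℕ) (k : Fin 2) :
    mass (W.requestProb n) (W.file n) (W.route₂ n) k =
      W.fileMass (W.rate₀ k / W.totalRate) (Pi.single k (W.rate k / W.totalRate)) n := by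
  have hc : ∀ k, W.F₀ k = W.F₀ 0 := Fin.forall_fin_two.2 ⟨rfl, hcommon.symm⟩
  funext v
  rw [mass_eq_sum]
  rcases v with i | ⟨j, i⟩
  · simp [route₂, fileMass, hc, ite_and]
  · fin_cases j <;> fin_cases k <;> simp [route₂, fileMass]

theorem mass_route₃_zero (hcommon : W.F₀ 0 = W.F₀ 1) (n : ℕ) :
    mass (W.requestProb n) (W.file n) (W.route₃ n) 0 =
      W.fileMass ((W.rate₀ 0 + W.rate₀ 1) / W.totalRate) 0 n := by
  funext v
  rw [mass_eq_sum]
  rcases v with i | ⟨j, i⟩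
  · simp [route₃, fileMass, ← hcommon, add_div, add_mul]
  · simp [route₃, fileMass]

theorem mass_route₃_succ (n : ℕ) (k : Fin 2) :
    mass (W.requestProb n) (W.file n) (W.route₃ n) k.succ =
      W.fileMass 0 (Pi.single k (W.rate k / W.totalRate)) n := by
  funext v
  rw [mass_eq_sum]
  rcases v with i | ⟨j, i⟩
  · simp [route₃, fileMass, (Fin.succ_ne_zero k).symm]
  · fin_cases j <;> fin_cases k <;> simp [route₃, fileMass]

end RequestLaw

end Workload

namespace Workload

variable {W : Workload}

theorem isCompact_allocations (P : Type) [Fintype P] (β : ℝ) : IsCompact (allocations P β) := by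
  refine (isCompact_Icc (a := fun _ : P => (0 : ℝ)) (b := fun _ => β)).of_isClosed_subset ?_ ?_
  · have h : allocations P β = (⋂ p, {γ : P → ℝ | 0 ≤ γ p}) ∩ {γ | ∑ p, γ p ≤ β} := by
      ext γ
      simp [allocations]
    rw [h]
    exact (isClosed_iInter fun p => isClosed_le continuous_const (continuous_apply p)).inter
      (isClosed_le (continuous_finsetSum _ fun p _ => continuous_apply p) continuous_const)
  · intro γ hγ
    exact ⟨hγ.1, fun p => (Finset.single_le_sum (fun q _ => hγ.1 q) (Finset.mem_univ p)).trans hγ.2⟩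

/-- The asymptotic aggregate hit probability and its maximum, if the files of each partition have
probabilities as in `fileMass`. -/
theorem exists_isOptimalHitProb (hb₀ : 0 < W.b₀) (hb : ∀ k, 0 < W.b k)
    (hF₀ : ∀ k, IsPopularityDistribution (W.F₀ k)) (hF : ∀ k, IsPopularityDistribution (W.F k))
    (hrate₀ : ∀ k, 0 < W.rate₀ k) (hrate : ∀ k, 0 < W.rate k)
    {P : Type} [Fintype P] [DecidableEq P] {route : ∀ n, W.Request n → P} {a₀ : P → ℝ}
    {a : P → Fin 2 → ℝ} (ha₀ : ∀ p, 0 ≤ a₀ p) (ha : ∀ p j, 0 ≤ a p j)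
    (hmass : ∀ n p, mass (W.requestProb n) (W.file n) (route n) p = W.fileMass (a₀ p) (a p) n)
    (hprof : ∀ p, IsProfile (W.fileK (a₀ p) (a p)) (W.fileH (a₀ p) (a p)) (a₀ p + ∑ j, a p j))
    {β : ℝ} (hβ : 0 ≤ β) :
    ∃ M, W.IsOptimalHitProb route β M ∧ IsGreatest
      ((fun γ => ∑ p, hitLimit (W.fileK (a₀ p) (a p)) (W.fileH (a₀ p) (a p)) (γ p)) ''
        allocations P β) M := by
  have hq := requestProb_nonneg hF₀ hF hrate₀ hrate
  have hq1 := fun n (hn : 0 < n) => sum_requestProb hb₀ hb hF₀ hF hrate₀ hrate hn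
  have hsum : ∀ p, a₀ p + ∑ j, a p j ≤ 1 := fun p => by
    rw [← sum_fileMass hb₀ hb hF₀ hF Nat.one_pos, ← hmass]
    exact sum_mass_le_one (hq 1) (hq1 1 Nat.one_pos)
  have ha₀1 : ∀ p, a₀ p ∈ Set.Icc (0 : ℝ) 1 := fun p =>
    ⟨ha₀ p, by linarith [hsum p, Finset.sum_nonneg fun j (_ : j ∈ Finset.univ) => ha p j]⟩
  have ha1 : ∀ p j, a p j ∈ Set.Icc (0 : ℝ) 1 := fun p j =>
    ⟨ha p j, by linarith [hsum p, ha₀ p,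
      Finset.single_le_sum (fun j _ => ha p j) (Finset.mem_univ j)]⟩
  have husc : UpperSemicontinuousOn (fun γ : P → ℝ =>
      ∑ p, hitLimit (W.fileK (a₀ p) (a p)) (W.fileH (a₀ p) (a p)) (γ p)) (allocations P β) :=
    upperSemicontinuousOn_sum fun p _ =>
      (hprof p).upperSemicontinuousOn_hitLimit.comp (continuous_apply p).continuousOn
        fun γ hγ => hγ.1 p
  obtain ⟨γ, hγ, hmax⟩ := husc.exists_isMaxOn
    (⟨fun _ => 0, fun _ => le_rfl, by simpa using hβ⟩ : (allocations P β).Nonempty)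
    (isCompact_allocations P β)
  have hgreatest : IsGreatest ((fun γ : P → ℝ =>
      ∑ p, hitLimit (W.fileK (a₀ p) (a p)) (W.fileH (a₀ p) (a p)) (γ p)) '' allocations P β)
      (∑ p, hitLimit (W.fileK (a₀ p) (a p)) (W.fileH (a₀ p) (a p)) (γ p)) :=
    ⟨⟨γ, hγ, rfl⟩, by rintro _ ⟨γ', hγ', rfl⟩; exact hmax hγ'⟩
  refine ⟨_, ⟨_, fun γ hγ C hC => ?_, hgreatest⟩, hgreatest⟩
  have hex : ∀ p n, ∃ g, 0 < n → _ := fun p n => by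
    by_cases hn : 0 < n
    · obtain ⟨g, hg⟩ := exists_tendsto_partitionHit (file := W.file n) (route := route n)
        (C n) p (hq n) (hq1 n hn)
      exact ⟨g, fun _ => hg⟩
    · exact ⟨0, fun h => absurd h hn⟩
  choose g hg using hex
  refine ⟨fun n => ∑ p, g p n, fun n hn => ?_, ?_⟩
  · simp only [hitProbAfter_eq_sum]
    exact tendsto_finsetSum _ fun p _ => (hg p n hn).1
  · refine tendsto_finsetSum _ fun p _ => ?_
    simp only [hmass] at hg
    refine (hprof p).tendsto_hitLimit (hγ.1 p) (hC p) (N := fun n => Fintype.card (W.File n))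
      (B := W.b₀ + ∑ k, W.b k) (fun n => Nat.cast_nonneg _) (fun n => ?_)
      (fun τ hτ => tendsto_distinctMean_fileMass hb₀ hb hF₀ hF (ha₀1 p) (ha1 p) hτ)
      (fun τ hτ => tendsto_repeatProb_fileMass hb₀ hb hF₀ hF (ha₀1 p) (ha1 p) hτ)
      (fun n hn => (hg p n hn).2.1) (fun n hn => ?_) (fun n hn => (hg p n hn).2.2.2.1)
      (fun n hn => (hg p n hn).2.2.2.2)
    · simp [Fintype.card_sum, Fintype.card_sigma, add_mul]
    · rw [← sum_fileMass hb₀ hb hF₀ hF hn]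
      exact (hg p n hn).2.2.1

variable (W) in
theorem fileK_single (a₀ c τ : ℝ) (k : Fin 2) :
    W.fileK a₀ (Pi.single k c) τ = W.b₀ * distinctLimit (W.F₀ 0) (τ * (a₀ / W.b₀)) +
      W.b k * distinctLimit (W.F k) (τ * (c / W.b k)) := by
  rw [fileK, Finset.sum_eq_single k]
  · simp
  · intro j _ hj
    simp [Pi.single_eq_of_ne hj, distinctLimit]
  · simp

variable (W) in
theorem fileH_single (a₀ c τ : ℝ) (k : Fin 2) :
    W.fileH a₀ (Pi.single k c) τ = a₀ * repeatLimit (W.F₀ 0) (τ * (a₀ / W.b₀)) +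
      c * repeatLimit (W.F k) (τ * (c / W.b k)) := by
  rw [fileH, Finset.sum_eq_single k]
  · simp
  · intro j _ hj
    simp [Pi.single_eq_of_ne hj]
  · simp

section Profiles

variable (hb₀ : 0 < W.b₀) (hb : ∀ k, 0 < W.b k)
  (hF₀ : ∀ k, IsPopularityDistribution (W.F₀ k)) (hF : ∀ k, IsPopularityDistribution (W.F k))

include hb₀ hF₀ in
theorem isProfile_common {a₀ : ℝ} (ha₀ : 0 < a₀) :
    IsProfile (fun τ => W.b₀ * distinctLimit (W.F₀ 0) (τ * (a₀ / W.b₀)))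
      (fun τ => a₀ * repeatLimit (W.F₀ 0) (τ * (a₀ / W.b₀))) a₀ := by
  have hb₀' : (0 : ℝ) < W.b₀ := by exact_mod_cast hb₀
  simpa using (hF₀ 0).isProfile.scale ha₀ hb₀' (div_pos ha₀ hb₀')

include hb hF in
theorem isProfile_private {c : ℝ} (hc : 0 < c) (k : Fin 2) :
    IsProfile (fun τ => W.b k * distinctLimit (W.F k) (τ * (c / W.b k)))
      (fun τ => c * repeatLimit (W.F k) (τ * (c / W.b k))) c := by
  have hb' : (0 : ℝ) < W.b k := by exact_mod_cast hb k
  simpa using (hF k).isProfile.scale hc hb' (div_pos hc hb')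

include hb₀ hF₀ in
theorem isProfile_file_zero {a₀ : ℝ} (ha₀ : 0 < a₀) :
    IsProfile (W.fileK a₀ 0) (W.fileH a₀ 0) (a₀ + ∑ j, (0 : Fin 2 → ℝ) j) := by
  convert isProfile_common hb₀ hF₀ ha₀ using 1
  · funext τ
    simp [fileK, distinctLimit]
  · funext τ
    simp [fileH]
  · simp

include hb hF in
theorem isProfile_file_single {c : ℝ} (hc : 0 < c) (k : Fin 2) :
    IsProfile (W.fileK 0 (Pi.single k c)) (W.fileH 0 (Pi.single k c))
      (0 + ∑ j, (Pi.single k c : Fin 2 → ℝ) j) := by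
  convert isProfile_private hb hF hc k using 1
  · funext τ
    simp [fileK_single, distinctLimit]
  · funext τ
    simp [fileH_single]
  · simp

include hb₀ hb hF₀ hF in
theorem isProfile_file {a₀ c : ℝ} (ha₀ : 0 < a₀) (hc : 0 < c) (k : Fin 2) :
    IsProfile (W.fileK a₀ (Pi.single k c)) (W.fileH a₀ (Pi.single k c))
      (a₀ + ∑ j, (Pi.single k c : Fin 2 → ℝ) j) := by
  convert (isProfile_common hb₀ hF₀ ha₀).add (isProfile_private hb hF hc k) using 1
  · funext τ
    simp [fileK_single]
  · funext τ
    simp [fileH_single]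
  · simp

end Profiles

end Workload

namespace Workload

variable {W : Workload}

/-- Windows `τ k` of the partitions under Strategy 2 can be replaced by windows under Strategy 3
with at least as many hits that need at most as much space: a common file is kept for the longer
of its two windows. -/
theorem exists_windows_of_windows (hb₀ : 0 < W.b₀)
    (hF₀ : ∀ k, IsPopularityDistribution (W.F₀ k)) (hF : ∀ k, IsPopularityDistribution (W.F k))
    {a c τ : Fin 2 → ℝ} (ha : ∀ k, 0 < a k) (hτ : ∀ k, 0 ≤ τ k) :
    ∃ s, 0 ≤ s ∧
      W.fileK (a 0 + a 1) 0 s + ∑ k, W.fileK 0 (Pi.single k (c k)) (τ k)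
        ≤ ∑ k, W.fileK (a k) (Pi.single k (c k)) (τ k) ∧
      ∑ k, W.fileH (a k) (Pi.single k (c k)) (τ k)
        ≤ W.fileH (a 0 + a 1) 0 s + ∑ k, W.fileH 0 (Pi.single k (c k)) (τ k) := by
  have hb₀' : (0 : ℝ) < W.b₀ := by exact_mod_cast hb₀
  have hpos : 0 < a 0 + a 1 := add_pos (ha 0) (ha 1)
  have hprof := (hF₀ 0).isProfile
  have hw : ∀ k, 0 ≤ τ k * (a k / W.b₀) := fun k =>
    mul_nonneg (hτ k) (div_nonneg (ha k).le hb₀'.le)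
  have hK0 : ∀ k, 0 ≤ distinctLimit (W.F₀ 0) (τ k * (a k / W.b₀)) := fun k => hprof.nonnegK (hw k)
  set u := max (τ 0 * (a 0 / W.b₀)) (τ 1 * (a 1 / W.b₀)) with hu
  have hu0 : 0 ≤ u := (hw 0).trans (le_max_left _ _)
  have hsu : u * (W.b₀ / (a 0 + a 1)) * ((a 0 + a 1) / W.b₀) = u := by field_simp
  refine ⟨u * (W.b₀ / (a 0 + a 1)), by positivity, ?_, ?_⟩
  · have h : distinctLimit (W.F₀ 0) u ≤ distinctLimit (W.F₀ 0) (τ 0 * (a 0 / W.b₀)) +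
        distinctLimit (W.F₀ 0) (τ 1 * (a 1 / W.b₀)) := by
      rcases max_choice (τ 0 * (a 0 / W.b₀)) (τ 1 * (a 1 / W.b₀)) with h | h <;> rw [hu, h]
      · linarith [hK0 1]
      · linarith [hK0 0]
    have h' := mul_le_mul_of_nonneg_left h hb₀'.le
    simp only [fileK_single, Fin.sum_univ_two]
    simp only [fileK, hsu]
    simp only [Pi.zero_apply, zero_div, mul_zero, hprof.zeroK, (hF _).isProfile.zeroK,
      Finset.sum_const_zero]
    linarith
  · have h0 := mul_le_mul_of_nonneg_left (hprof.monoH (hw 0) hu0 (le_max_left _ _)) (ha 0).le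
    have h1 := mul_le_mul_of_nonneg_left (hprof.monoH (hw 1) hu0 (le_max_right _ _)) (ha 1).le
    simp only [fileH_single, Fin.sum_univ_two]
    simp only [fileH, hsu]
    simp only [Pi.zero_apply, zero_mul, Finset.sum_const_zero]
    linarith

/-- Under an optimal allocation, pooling the common content is at least as good as separate
partitions for the providers. -/
theorem exists_isOptimalHitProb_le {β : ℝ}
    (hb₀ : 0 < W.b₀) (hb : ∀ k, 0 < W.b k)
    (hrate₀ : ∀ k, 0 < W.rate₀ k) (hrate : ∀ k, 0 < W.rate k)
    (hF₀ : ∀ k, IsPopularityDistribution (W.F₀ k))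
    (hF : ∀ k, IsPopularityDistribution (W.F k))
    (hcommon : W.F₀ 0 = W.F₀ 1)
    (hβ : 0 ≤ β) :
    ∃ M₂ M₃ : ℝ,
      W.IsOptimalHitProb W.route₂ β M₂ ∧ W.IsOptimalHitProb W.route₃ β M₃ ∧ M₂ ≤ M₃ := by
  have hΛ := totalRate_pos hrate₀ hrate
  set a : Fin 2 → ℝ := fun k => W.rate₀ k / W.totalRate
  set c : Fin 2 → ℝ := fun k => W.rate k / W.totalRate
  have ha : ∀ k, 0 < a k := fun k => div_pos (hrate₀ k) hΛ
  have hc : ∀ k, 0 < c k := fun k => div_pos (hrate k) hΛ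
  have hsingle : ∀ k j, 0 ≤ (Pi.single k (c k) : Fin 2 → ℝ) j := fun k j =>
    (Pi.single_nonneg.2 (hc k).le : (0 : Fin 2 → ℝ) ≤ Pi.single k (c k)) j
  have hprof₂ := fun k => isProfile_file hb₀ hb hF₀ hF (ha k) (hc k) k
  have hprof₃₀ := isProfile_file_zero hb₀ hF₀ (add_pos (ha 0) (ha 1))
  have hprof₃ := fun k => isProfile_file_single hb hF (hc k) k
  obtain ⟨M₂, hM₂, ⟨γ, hγ, hγM⟩, -⟩ := exists_isOptimalHitProb hb₀ hb hF₀ hF hrate₀ hrate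
    (route := W.route₂) (a₀ := a) (a := fun k => Pi.single k (c k)) (fun k => (ha k).le) hsingle
    (fun n k => mass_route₂ hcommon n k) hprof₂ hβ
  obtain ⟨M₃, hM₃, -, hmax⟩ := exists_isOptimalHitProb hb₀ hb hF₀ hF hrate₀ hrate
    (route := W.route₃) (a₀ := Fin.cons (a 0 + a 1) fun _ => 0)
    (a := Fin.cons 0 fun k => Pi.single k (c k))
    (Fin.cases (add_pos (ha 0) (ha 1)).le fun _ => le_rfl)
    (Fin.cases (fun _ => le_rfl) fun k => hsingle k)
    (fun n => Fin.cases (by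
        rw [mass_route₃_zero hcommon, add_div]
        rfl)
      fun k => mass_route₃_succ n k)
    (Fin.cases hprof₃₀ hprof₃) hβ
  refine ⟨M₂, M₃, hM₂, hM₃, le_of_forall_pos_sub_le fun ε hε => ?_⟩
  have hτ := fun k => (hprof₂ k).exists_of_lt_hitLimit (hγ.1 k) (sub_lt_self _ (half_pos hε))
  choose τ hτ0 hτK hτH using hτ
  obtain ⟨s, hs0, hsK, hsH⟩ := exists_windows_of_windows (c := c) hb₀ hF₀ hF ha hτ0
  have hK₀ := hprof₃₀.nonnegK hs0
  have hK := fun k => (hprof₃ k).nonnegK (hτ0 k)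
  have hmem : (Fin.cons (W.fileK (a 0 + a 1) 0 s) fun k => W.fileK 0 (Pi.single k (c k)) (τ k) :
      Fin 3 → ℝ) ∈ allocations (Fin 3) β := by
    refine ⟨Fin.cases hK₀ hK, ?_⟩
    rw [Fin.sum_univ_succ]
    simp only [Fin.cons_zero, Fin.cons_succ]
    exact hsK.trans ((Finset.sum_le_sum fun k _ => hτK k).trans hγ.2)
  have hle := hmax ⟨_, hmem, rfl⟩
  dsimp only at hle
  rw [Fin.sum_univ_succ] at hle
  simp only [Fin.cons_zero, Fin.cons_succ] at hle
  have h0 := hprof₃₀.le_hitLimit hs0 le_rfl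
  have h1 := Finset.sum_le_sum fun k (_ : k ∈ Finset.univ) =>
    (hprof₃ k).le_hitLimit (hτ0 k) le_rfl
  have h2 := Finset.sum_le_sum fun k (_ : k ∈ Finset.univ) => (hτH k).le
  rw [Finset.sum_sub_distrib] at h2
  have h3 : ∑ _k : Fin 2, ε / 2 = ε := by
    rw [Fin.sum_univ_two]
    ring
  dsimp only at hγM
  linarith

end Workload

end LRUCache

theorem theorem5 (W : LRUCache.Workload) (β : ℝ)
    (hb₀ : 0 < W.b₀) (hb : ∀ k, 0 < W.b k)
    (hrate₀ : ∀ k, 0 < W.rate₀ k) (hrate : ∀ k, 0 < W.rate k)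
    (hF₀ : ∀ k, LRUCache.IsPopularityDistribution (W.F₀ k))
    (hF : ∀ k, LRUCache.IsPopularityDistribution (W.F k))
    (hcommon : W.F₀ 0 = W.F₀ 1)
    (hβ : 0 ≤ β) :
    ∃ M₂ M₃ : ℝ,
      W.IsOptimalHitProb W.route₂ β M₂ ∧ W.IsOptimalHitProb W.route₃ β M₃ ∧ M₂ ≤ M₃ :=
  LRUCache.Workload.exists_isOptimalHitProb_le hb₀ hb hrate₀ hrate hF₀ hF hcommon hβ
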